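/- Represent the circle $\mathbb S^1$ by $[0,2\pi)$ with Lebesgue measure; write $\|\cdot\|_2$ and $\langle\cdot,\cdot\rangle_2$ for the norm and scalar product of $\mathbb L^2(\mathbb S^1)$ and $\|\cdot\|_\infty$ for the essential supremum norm. For $l,u\in\mathbb S^1$ let $[l,u]$ be the usual interval if $l\le u$, and $[l,2\pi)\cup[0,u]$ if $l>u$. Let $(X_i,L_i,U_i)_{1\le i\le n}$ be independent and identically distributed triplets of circular random variables such that $(X_i)_i$ is independent of $(L_i,U_i)_i$, $L_i\ne U_i$ a.s., and $X_i$ has density $f$. One observes $(X_i',\Delta_i,L_i,U_i)$, where $\Delta_i=\mathbf 1_{\{X_i\in[L_i,U_i]\}}$, $X_i'=X_i$ if $\Delta_i=1$ and $X_i'=-\pi$ otherwise. Let $\sigma(x)=\mathbb P(x\in[L_1,U_1])$. Let $\varphi_0=\frac1{\sqrt{2\pi}}$, $\varphi_{2j-1}=\frac1{\sqrt\pi}\cos(j\,\cdot)$, $\varphi_{2j}=\frac1{\sqrt\pi}\sin(j\,\cdot)$ for $j\ge1$, let $S_m$ be the span of $\varphi_0,\dots,\varphi_{2m}$, of dimension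 $D_m=2m+1$, and let $\mathcal M_n=\{1,\dots,\lfloor n/2\rfloor-1\}$. Let $\mathring f_m$ be a minimizer over $t\in S_m$ of $$\zeta(t)=\frac1n\sum_{i=1}^n\Big(\int_{\mathbb S^1}t^2(x)\mathbf 1_{\{x\in[L_i,U_i]\}}\,dx-2\Delta_i t(X_i')\Big),$$ and let $\tilde f_m=\mathring f_m$ if $\|\mathring f_m\|_2^2\le n^2$ and $\tilde f_m=0$ otherwise. **Theorem.** Assume that $f\in\mathbb L^\infty(\mathbb S^1)$ and that there is $\sigma_0>0$ with $\sigma(x)\ge\sigma_0$ for all $x\in\mathbb S^1$. Then, for all $n$ and all $m\in\mathcal M_n$, the minimizer $\mathring f_m$ exists and is unique almost surely, $\|\tilde f_m-f\|_2^2$ is integrable, and $$\mathbb E\big(\|\tilde f_m-f\|_2^2\big)\le C_1\|f_m-f\|_2^2+C_2\frac{D_m}n+C_3\frac1n,$$ where $f_m$ is the orthogonal projection of $f$ on $S_m$, $C_1$ and $C_2$ depend only on $\sigma_0$, and $C_3$ depends only on $\sigma_0$ and $\|f\|_\infty$. In particular, let $\beta,R>0$ and suppose in addition that $f$ belongs to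 the Sobolev class $$W(\beta,R)=\Big\{g\in\mathbb L^2(\mathbb S^1):\ \sum_{j\ge0}\alpha_j^2\langle g,\varphi_j\rangle_2^2<\frac{R^2}{\pi^{2\beta}}\Big\},\qquad \alpha_j=j^\beta\ (j\text{ even}),\quad \alpha_j=(j+1)^\beta\ (j\text{ odd}).$$ If $m\in\mathcal M_n$ is such that $a\,n^{1/(2\beta+1)}\le D_m\le b\,n^{1/(2\beta+1)}$ for constants $a,b>0$, then $$\mathbb E\big(\|\tilde f_m-f\|_2^2\big)\le C\,n^{-2\beta/(2\beta+1)},$$ with $C$ depending only on $\beta,R,a,b,\sigma_0$ and $\|f\|_\infty$; so $\tilde f_{m_n}$ has risk $\mathcal O(n^{-2\beta/(2\beta+1)})$ for every such sequence $m_n$. -/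

import Mathlib

open MeasureTheory ProbabilityTheory

noncomputable section

namespace CircCensor

/-- The circle, represented by the angles in `[0, 2π)`. -/
def circle : Set ℝ := Set.Ico 0 (2 * Real.pi)

/-- Lebesgue measure on the circle `[0, 2π)`. -/
def circleVol : Measure ℝ := volume.restrict circle

/-- The closed circular arc `[l, u]`, run through anticlockwise from `l` to `u`: it is the usual
interval when `l ≤ u`, and `[0, 2π) \ (u, l) = [l, 2π) ∪ [0, u]` when `u < l`. -/
def arc (l u : ℝ) : Set ℝ := if l ≤ u then Set.Icc l u else circle \ Set.Ioo u l

/-- Scalar product of `L²` of the circle. -/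
def inner2 (g h : ℝ → ℝ) : ℝ := ∫ x, g x * h x ∂circleVol

/-- Squared norm of `L²` of the circle. -/
def normSq2 (g : ℝ → ℝ) : ℝ := ∫ x, g x ^ 2 ∂circleVol

/-- Essential supremum norm on the circle. -/
def supNorm (g : ℝ → ℝ) : ℝ := (eLpNorm g ⊤ circleVol).toReal

/-- Trigonometric basis: `φ 0 = 1/√(2π)`, and for `k ≥ 1`,
`φ (2k-1) = cos (k x)/√π`, `φ (2k) = sin (k x)/√π`. -/
def trig (j : ℕ) (x : ℝ) : ℝ :=
  if j = 0 then 1 / Real.sqrt (2 * Real.pi)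
  else if Odd j then Real.cos ((((j + 1) / 2 : ℕ) : ℝ) * x) / Real.sqrt Real.pi
  else Real.sin (((j / 2 : ℕ) : ℝ) * x) / Real.sqrt Real.pi

/-- The dimension `D_m = 2m + 1`. -/
def dimS (m : ℕ) : ℕ := 2 * m + 1

/-- The trigonometric space `S_m`, spanned by `φ 0, …, φ (2m)`. -/
def trigSpace (m : ℕ) : Submodule ℝ (ℝ → ℝ) :=
  Submodule.span ℝ (trig '' {j | j < dimS m})

/-- The admissible indices `{1, …, ⌊n/2⌋ - 1}` at sample size `n`. -/
def indexSet (n : ℕ) : Finset ℕ := Finset.Icc 1 (n / 2 - 1)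

/-- `g` is the orthogonal projection of `f` on `S_m` in `L²` of the circle. -/
def IsProjection (m : ℕ) (f g : ℝ → ℝ) : Prop :=
  g ∈ trigSpace m ∧ ∀ t ∈ trigSpace m, inner2 (fun x => f x - g x) t = 0

/-- Weights of the Sobolev class. -/
def sobolevWeight (β : ℝ) (j : ℕ) : ℝ :=
  if Even j then (j : ℝ) ^ β else ((j : ℝ) + 1) ^ β

/-- The Sobolev class `W(β, R)`. -/
def sobolevClass (β R : ℝ) : Set (ℝ → ℝ) :=
  {g | MemLp g 2 circleVol ∧
    Summable (fun j : ℕ => sobolevWeight β j ^ 2 * inner2 g (trig j) ^ 2) ∧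
    ∑' j : ℕ, sobolevWeight β j ^ 2 * inner2 g (trig j) ^ 2 < R ^ 2 / Real.pi ^ (2 * β)}

/-- What is observed for one individual: the value `X'`, the indicator `Δ`, and the bounds
`L`, `U` of the observation window. -/
structure Obs where
  value : ℝ
  ind : ℝ
  left : ℝ
  right : ℝ

open Classical in
/-- The censoring mechanism: `X' = X` and `Δ = 1` if `X ∈ [L, U]`; `X' = -π` and `Δ = 0`
otherwise. -/
def observe (x l u : ℝ) : Obs where
  value := if x ∈ arc l u then x else -Real.pi
  ind := if x ∈ arc l u then 1 else 0
  left := l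
  right := u

/-- The empirical contrast
`ζ(t) = (1/n) ∑ i, (∫ t² 1_{[L i, U i]} - 2 Δ i t(X' i))`. -/
def contrast {n : ℕ} (o : Fin n → Obs) (t : ℝ → ℝ) : ℝ :=
  (1 / (n : ℝ)) * ∑ i, ((∫ x, (arc (o i).left (o i).right).indicator (fun y => t y ^ 2) x ∂circleVol)
    - 2 * (o i).ind * t (o i).value)

/-- `t` minimizes the contrast over `S_m`. -/
def IsLeastSquares {n : ℕ} (o : Fin n → Obs) (m : ℕ) (t : ℝ → ℝ) : Prop :=
  t ∈ trigSpace m ∧ ∀ s ∈ trigSpace m, contrast o t ≤ contrast o s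

open Classical in
/-- The least-squares estimator: a minimizer of the contrast over `S_m` (and `0` for data
for which there is none). -/
def lsEstimator {n : ℕ} (o : Fin n → Obs) (m : ℕ) : ℝ → ℝ :=
  if h : ∃ t, IsLeastSquares o m t then h.choose else 0

open Classical in
/-- The truncated estimator: the least-squares estimator if its squared norm is at most
`k_n = n²`, and `0` otherwise. -/
def truncEstimator {n : ℕ} (o : Fin n → Obs) (m : ℕ) : ℝ → ℝ :=
  if normSq2 (lsEstimator o m) ≤ (n : ℝ) ^ 2 then lsEstimator o m else 0

/-- `σ(x) = P(x ∈ [L, U])`, where `ν` is the law of `(L, U)`. -/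
def sigma (ν : Measure (ℝ × ℝ)) (x : ℝ) : ℝ := ν.real {p | x ∈ arc p.1 p.2}

/-- `(X i, L i, U i)`, `i < n`, is a sample of the circular censoring model: the triplets are
independent, the sequence `(X i)` is independent of the sequence `(L i, U i)`, each `X i` has
density `f` on the circle, each `(L i, U i)` has law `ν`, and `L i ≠ U i` almost surely. -/
structure IsCensoredSample {Ω : Type*} [MeasurableSpace Ω] (P : Measure Ω) (f : ℝ → ℝ)
    (ν : Measure (ℝ × ℝ)) {n : ℕ} (X L U : Fin n → Ω → ℝ) : Prop where
  measurable_X : ∀ i, Measurable (X i)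
  measurable_L : ∀ i, Measurable (L i)
  measurable_U : ∀ i, Measurable (U i)
  mem_X : ∀ i ω, X i ω ∈ circle
  mem_L : ∀ i ω, L i ω ∈ circle
  mem_U : ∀ i ω, U i ω ∈ circle
  law_X : ∀ i, P.map (X i) = circleVol.withDensity (fun x => ENNReal.ofReal (f x))
  law_LU : ∀ i, P.map (fun ω => (L i ω, U i ω)) = ν
  ne_LU : ∀ i, ∀ᵐ ω ∂P, L i ω ≠ U i ω
  indep_triplets : iIndepFun (fun i ω => (X i ω, L i ω, U i ω)) P
  indep_X_LU : IndepFun (fun ω i => X i ω) (fun ω i => (L i ω, U i ω)) P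

/-- The observations of the whole sample at the outcome `ω`. -/
def sampleObs {Ω : Type*} {n : ℕ} (X L U : Fin n → Ω → ℝ) (ω : Ω) : Fin n → Obs :=
  fun i => observe (X i ω) (L i ω) (U i ω)

/-- The integrated squared error of the truncated estimator at the outcome `ω`. -/
def ise {Ω : Type*} {n : ℕ} (X L U : Fin n → Ω → ℝ) (m : ℕ) (f : ℝ → ℝ) (ω : Ω) : ℝ :=
  normSq2 (fun x => truncEstimator (sampleObs X L U ω) m x - f x)

end CircCensor

end

noncomputable section

namespace CircCensor

/-! On coefficient vectors the contrast is the quadratic `c ⬝ᵥ G c - 2 c ⬝ᵥ b`, where `G` is the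
Gram matrix of the basis weighted by the empirical coverage (`empCover`, the share of windows that
contain a point) and `b` is the vector of empirical coefficients. A single arc with distinct
endpoints contains an interval, and a nonzero trigonometric polynomial, being analytic, cannot
vanish on an interval. So `G` is almost surely positive definite (`gram_pos`), and the minimizer
exists, is unique, and is `G⁻¹ b`.

For the risk, the main point is that the empirical coverage stays uniformly above `σ₀ / 2` outside
an event of probability `O(n⁻³)` (`exists_event_half_cover`). Indeed the indicator of an arc is a
combination of two half-line indicators and the indicator of `{u < l}`, so the coverage is built
from two empirical distribution functions and one frequency. Hoeffding's inequality on a grid of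
quantiles controls each of them from below.

On the good event `G ≥ (σ₀ / 2) I`. The normal equations and Young's inequality then bound the
coefficient error by the bias plus the squared norm of `noise` (`sum_lsCoeff_sub_sq_le`). The noise
is centred with the empirical, not the true, coverage. Hence it has mean zero once the windows are
fixed, and its expected squared norm is at most `D_m / n` (`integral_sum_noise_sq_le`). If moreover
`n ≥ 4 / σ₀²`, the truncation is inactive there. Everywhere else the truncation bounds the error by
`2 n² + 2 ‖f‖₂²`, which multiplied by `n⁻³` gives the `1 / n` term; boundedness of `f` serves to
bound `‖f‖₂` in it.

For the rate, the bias is a tail of Fourier coefficients by Parseval, at most a constant times `D_m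
^ (-2β)` on the Sobolev class, and this balances `D_m / n`. -/

instance : IsFiniteMeasure circleVol := by
  refine ⟨?_⟩
  rw [circleVol, circle, Measure.restrict_apply_univ, Real.volume_Ico]
  exact ENNReal.ofReal_lt_top

lemma measurableSet_circle : MeasurableSet circle := measurableSet_Ico

lemma integral_circleVol (g : ℝ → ℝ) :
    ∫ x, g x ∂circleVol = ∫ x in (0 : ℝ)..(2 * Real.pi), g x := by
  rw [circleVol, circle, integral_Ico_eq_integral_Ioc,
    intervalIntegral.integral_of_le (by positivity)]

lemma ae_circleVol_mem : ∀ᵐ x ∂circleVol, x ∈ circle :=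
  ae_restrict_mem measurableSet_circle

lemma circleVol_real_univ : circleVol.real Set.univ = 2 * Real.pi := by
  have : (0 : ℝ) ≤ Real.pi := by positivity
  simp [Measure.real, circleVol, circle, this]

/-! ### The trigonometric basis: orthonormality and Parseval's identity. -/

lemma trig_zero (x : ℝ) : trig 0 x = 1 / Real.sqrt (2 * Real.pi) := by simp [trig]

lemma trig_odd (k : ℕ) (x : ℝ) :
    trig (2 * k + 1) x = Real.cos (((k : ℝ) + 1) * x) / Real.sqrt Real.pi := by
  have h1 : Odd (2 * k + 1) := ⟨k, rfl⟩
  have h2 : (2 * k + 1 + 1) / 2 = k + 1 := by omega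
  simp only [trig, h1, h2, if_true]
  simp

lemma trig_even (k : ℕ) (x : ℝ) :
    trig (2 * k + 2) x = Real.sin (((k : ℝ) + 1) * x) / Real.sqrt Real.pi := by
  have h1 : ¬ Odd (2 * k + 2) := by rw [Nat.not_odd_iff_even]; exact ⟨k + 1, by ring⟩
  have h2 : (2 * k + 2) / 2 = k + 1 := by omega
  simp only [trig, h1, h2]
  simp

/-- Sorts the basis into constant, cosines and sines; `k` is the frequency minus one, which keeps it
positive without a side condition. -/
lemma index_cases (j : ℕ) : j = 0 ∨ ∃ k, j = 2 * k + 1 ∨ j = 2 * k + 2 := by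
  rcases Nat.even_or_odd' j with ⟨k, h | h⟩
  · rcases k with _ | k
    · left; omega
    · right; exact ⟨k, by omega⟩
  · right; exact ⟨k, by omega⟩

lemma analyticOnNhd_trig (j : ℕ) : AnalyticOnNhd ℝ (trig j) Set.univ := by
  rcases index_cases j with rfl | ⟨k, rfl | rfl⟩
  · rw [funext trig_zero]; exact analyticOnNhd_const
  · rw [funext (trig_odd k)]
    intro x _
    exact (Real.analyticAt_cos.comp (analyticAt_const.mul analyticAt_id)).div_const
  · rw [funext (trig_even k)]
    intro x _
    exact (Real.analyticAt_sin.comp (analyticAt_const.mul analyticAt_id)).div_const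

lemma continuous_trig (j : ℕ) : Continuous (trig j) :=
  continuousOn_univ.1 (analyticOnNhd_trig j).continuousOn

lemma integral_cos_mul_circle (k : ℤ) :
    ∫ x, Real.cos (k * x) ∂circleVol = if k = 0 then 2 * Real.pi else 0 := by
  rw [integral_circleVol]
  split_ifs with h
  · simp [h]
  · have h' : (k : ℝ) ≠ 0 := by exact_mod_cast h
    rw [intervalIntegral.integral_comp_mul_left (fun x => Real.cos x) h', integral_cos]
    have : Real.sin ((k : ℝ) * (2 * Real.pi)) = 0 := by
      have := Real.sin_int_mul_pi (2 * k)
      rw [← this]; push_cast; ring_nf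
    simp [this]

lemma integral_sin_mul_circle (k : ℤ) : ∫ x, Real.sin (k * x) ∂circleVol = 0 := by
  rw [integral_circleVol]
  by_cases h : k = 0
  · simp [h]
  · have h' : (k : ℝ) ≠ 0 := by exact_mod_cast h
    rw [intervalIntegral.integral_comp_mul_left (fun x => Real.sin x) h', integral_sin]
    have : Real.cos ((k : ℝ) * (2 * Real.pi)) = 1 := Real.cos_int_mul_two_pi k
    simp [this]

lemma integrable_of_continuous {g : ℝ → ℝ} (hg : Continuous g) : Integrable g circleVol := by
  refine IntegrableOn.mono_set (t := Set.Icc 0 (2 * Real.pi)) ?_ Set.Ico_subset_Icc_self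
  exact hg.continuousOn.integrableOn_compact isCompact_Icc

lemma integral_cos_mul_cos (k l : ℤ) :
    ∫ x, Real.cos (k * x) * Real.cos (l * x) ∂circleVol
      = ((if k - l = 0 then 2 * Real.pi else 0) + (if k + l = 0 then 2 * Real.pi else 0)) / 2 := by
  rw [← integral_cos_mul_circle, ← integral_cos_mul_circle, ← integral_add, ← integral_div]
  · congr 1; ext x
    push_cast
    rw [sub_mul, add_mul, Real.cos_sub, Real.cos_add]; ring
  all_goals exact integrable_of_continuous (by fun_prop)

lemma integral_sin_mul_sin (k l : ℤ) :
    ∫ x, Real.sin (k * x) * Real.sin (l * x) ∂circleVol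
      = ((if k - l = 0 then 2 * Real.pi else 0) - (if k + l = 0 then 2 * Real.pi else 0)) / 2 := by
  rw [← integral_cos_mul_circle, ← integral_cos_mul_circle, ← integral_sub, ← integral_div]
  · congr 1; ext x
    push_cast
    rw [sub_mul, add_mul, Real.cos_sub, Real.cos_add]; ring
  all_goals exact integrable_of_continuous (by fun_prop)

lemma integral_sin_mul_cos (k l : ℤ) :
    ∫ x, Real.sin (k * x) * Real.cos (l * x) ∂circleVol = 0 := by
  have : (0 : ℝ) = (0 + 0) / 2 := by norm_num
  rw [this]
  nth_rw 1 [← integral_sin_mul_circle (k - l)]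
  rw [← integral_sin_mul_circle (k + l), ← integral_add, ← integral_div]
  · congr 1; ext x
    push_cast
    rw [sub_mul, add_mul, Real.sin_sub, Real.sin_add]; ring
  all_goals exact integrable_of_continuous (by fun_prop)

lemma inner2_comm (g h : ℝ → ℝ) : inner2 g h = inner2 h g := by
  simp only [inner2, mul_comm]

/-- The trigonometric basis is orthonormal. -/
lemma inner2_trig (i j : ℕ) : inner2 (trig i) (trig j) = if i = j then 1 else 0 := by
  have hs : Real.sqrt Real.pi * Real.sqrt Real.pi = Real.pi := Real.mul_self_sqrt Real.pi_pos.le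
  have hs2 : Real.sqrt (2 * Real.pi) * Real.sqrt (2 * Real.pi) = 2 * Real.pi :=
    Real.mul_self_sqrt (by positivity)
  have cc : ∀ k l : ℕ, inner2 (trig (2 * k + 1)) (trig (2 * l + 1)) = if k = l then 1 else 0 := by
    intro k l
    have := integral_cos_mul_cos (k + 1) (l + 1)
    push_cast at this
    simp only [inner2, trig_odd, div_mul_div_comm, integral_div, this, hs]
    have h1 : ¬ ((k : ℤ) + 1 + (l + 1) = 0) := by omega
    by_cases h : k = l
    · subst h; simp [h1, Real.pi_pos.ne']
    · have h2 : ¬ ((k : ℤ) + 1 - (l + 1) = 0) := by omega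
      simp only [h1, h2, h, if_false]; simp
  have ss : ∀ k l : ℕ, inner2 (trig (2 * k + 2)) (trig (2 * l + 2)) = if k = l then 1 else 0 := by
    intro k l
    have := integral_sin_mul_sin (k + 1) (l + 1)
    push_cast at this
    simp only [inner2, trig_even, div_mul_div_comm, integral_div, this, hs]
    have h1 : ¬ ((k : ℤ) + 1 + (l + 1) = 0) := by omega
    by_cases h : k = l
    · subst h; simp [h1, Real.pi_pos.ne']
    · have h2 : ¬ ((k : ℤ) + 1 - (l + 1) = 0) := by omega
      simp only [h1, h2, h, if_false]; simp
  have sc : ∀ k l : ℕ, inner2 (trig (2 * k + 2)) (trig (2 * l + 1)) = 0 := by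
    intro k l
    have := integral_sin_mul_cos (k + 1) (l + 1)
    push_cast at this
    simp only [inner2, trig_even, trig_odd, div_mul_div_comm, integral_div, this, zero_div]
  have zc : ∀ l : ℕ, inner2 (trig 0) (trig (2 * l + 1)) = 0 := by
    intro l
    have := integral_cos_mul_circle (l + 1)
    have h1 : ¬ ((l : ℤ) + 1 = 0) := by omega
    push_cast at this
    simp only [inner2, trig_zero, trig_odd, integral_const_mul, integral_div, this, h1]
    simp
  have zs : ∀ l : ℕ, inner2 (trig 0) (trig (2 * l + 2)) = 0 := by
    intro l
    have := integral_sin_mul_circle (l + 1)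
    push_cast at this
    simp only [inner2, trig_zero, trig_even, integral_const_mul, integral_div, this]
    simp
  rcases index_cases i with rfl | ⟨k, rfl | rfl⟩ <;> rcases index_cases j with rfl | ⟨l, rfl | rfl⟩
  · simp only [inner2, trig_zero, div_mul_div_comm, hs2, integral_const, circleVol_real_univ,
      smul_eq_mul, mul_one, if_true]
    field_simp
  · simp [zc]
  · simp [zs]
  · simp [inner2_comm _ (trig 0), zc]
  · rw [cc]; simp
  · rw [inner2_comm, sc, if_neg (by omega)]
  · simp [inner2_comm _ (trig 0), zs]
  · rw [sc, if_neg (by omega)]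
  · rw [ss]; simp

lemma abs_trig_le_one (j : ℕ) (x : ℝ) : |trig j x| ≤ 1 := by
  have h1 : (1 : ℝ) ≤ Real.sqrt Real.pi := by
    rw [Real.one_le_sqrt]; linarith [Real.pi_gt_three]
  have h2 : (1 : ℝ) ≤ Real.sqrt (2 * Real.pi) := by
    rw [Real.one_le_sqrt]; linarith [Real.pi_gt_three]
  rcases index_cases j with rfl | ⟨k, rfl | rfl⟩
  · rw [trig_zero, abs_div, abs_one, abs_of_nonneg (Real.sqrt_nonneg _)]
    exact div_le_one_of_le₀ h2 (Real.sqrt_nonneg _)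
  · rw [trig_odd, abs_div, abs_of_nonneg (Real.sqrt_nonneg _)]
    exact div_le_one_of_le₀ ((Real.abs_cos_le_one _).trans h1) (Real.sqrt_nonneg _)
  · rw [trig_even, abs_div, abs_of_nonneg (Real.sqrt_nonneg _)]
    exact div_le_one_of_le₀ ((Real.abs_sin_le_one _).trans h1) (Real.sqrt_nonneg _)

lemma memLp_trig (j : ℕ) (p : ENNReal) : MemLp (trig j) p circleVol :=
  MemLp.of_bound (continuous_trig j).aestronglyMeasurable 1
    (Filter.Eventually.of_forall (abs_trig_le_one j))

/-- Parseval's identity for the trigonometric basis of the circle. -/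
lemma hasSum_sq_inner2_trig {f : ℝ → ℝ} (hf : MemLp f 2 circleVol) :
    HasSum (fun j => inner2 f (trig j) ^ 2) (normSq2 f) := by
  have hpi : (0 : ℝ) < 2 * Real.pi := by positivity
  have hfi : Integrable f circleVol := hf.integrable (by norm_num)
  have hrestr : circleVol = volume.restrict (Set.Ioc 0 (2 * Real.pi)) :=
    Measure.restrict_congr_set Ico_ae_eq_Ioc
  have hL2 : MemLp (fun x => (f x : ℂ)) 2 (volume.restrict (Set.Ioc 0 (2 * Real.pi))) := by
    rw [← hrestr]; exact hf.ofReal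
  have hP := hasSum_sq_fourierCoeffOn hpi hL2
  set F : ℤ → ℝ := fun i => ‖fourierCoeffOn hpi (fun x => (f x : ℂ)) i‖ ^ 2 with hF
  have hint : ∫ x in (0 : ℝ)..(2 * Real.pi), ‖(f x : ℂ)‖ ^ 2 = normSq2 f := by
    rw [normSq2, integral_circleVol]; simp
  rw [hint] at hP
  -- For real `f`, the complex coefficient has the cosine integral as real part and minus the sine
  -- integral as imaginary part, up to the factor `1 / (2π)`.
  have hFn : ∀ n : ℤ, F n = (1 / (2 * Real.pi)) ^ 2 *
      ((∫ x, f x * Real.cos (n * x) ∂circleVol) ^ 2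
        + (∫ x, f x * Real.sin (n * x) ∂circleVol) ^ 2) := by
    intro n
    have hc : Integrable (fun x => f x * Real.cos (n * x)) circleVol := by
      refine hfi.mul_bdd (c := 1) (by fun_prop)
        (Filter.Eventually.of_forall fun _ => Real.abs_cos_le_one _)
    have hs : Integrable (fun x => f x * Real.sin (n * x)) circleVol := by
      refine hfi.mul_bdd (c := 1) (by fun_prop)
        (Filter.Eventually.of_forall fun _ => Real.abs_sin_le_one _)
    have e : ∀ x : ℝ, fourier (-n) (x : AddCircle (2 * Real.pi - 0)) • (f x : ℂ)
        = ((f x * Real.cos (n * x) : ℝ) : ℂ) - ((f x * Real.sin (n * x) : ℝ) : ℂ) * Complex.I := by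
      intro x
      rw [fourier_coe_apply]
      have : 2 * (Real.pi : ℂ) * Complex.I * ((-n : ℤ) : ℂ) * (x : ℂ) / ((2 * Real.pi - 0 : ℝ) : ℂ)
          = ((-(n * x) : ℝ) : ℂ) * Complex.I := by
        have : (Real.pi : ℂ) ≠ 0 := by exact_mod_cast Real.pi_ne_zero
        push_cast
        rw [sub_zero]
        field_simp
      rw [this, Complex.exp_mul_I, ← Complex.ofReal_cos, ← Complex.ofReal_sin, Real.cos_neg,
        Real.sin_neg, smul_eq_mul]
      push_cast
      ring
    have hval : fourierCoeffOn hpi (fun x => (f x : ℂ)) n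
        = ((1 / (2 * Real.pi) : ℝ) : ℂ) * (((∫ x, f x * Real.cos (n * x) ∂circleVol : ℝ) : ℂ)
          - ((∫ x, f x * Real.sin (n * x) ∂circleVol : ℝ) : ℂ) * Complex.I) := by
      rw [fourierCoeffOn_eq_integral, intervalIntegral.integral_of_le hpi.le, ← hrestr]
      simp_rw [e]
      rw [integral_sub hc.ofReal (hs.ofReal.mul_const _), integral_mul_const,
        integral_complex_ofReal, integral_complex_ofReal, Complex.real_smul]
      push_cast
      simp
    simp only [hF]
    rw [hval, norm_mul, mul_pow, Complex.norm_real, Real.norm_eq_abs, sq_abs, Complex.sq_norm,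
      Complex.normSq_apply]
    simp
    ring
  -- Folding `ℤ` onto `ℕ` counts frequency zero twice; the extra `F 0` in the total accounts for
  -- this, and the next line removes the zeroth term.
  have h2 := hP.nat_add_neg
  have h3 := (hasSum_nat_add_iff' 1).2 h2
  simp only [Finset.range_one, Finset.sum_singleton] at h3
  have hsq : Real.sqrt Real.pi ^ 2 = Real.pi := Real.sq_sqrt Real.pi_pos.le
  set a : ℕ → ℝ := fun j => inner2 f (trig j) ^ 2 with ha
  have ha0 : a 0 = 2 * Real.pi * F 0 := by
    simp only [ha, hFn, inner2, trig_zero, integral_mul_const]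
    simp only [Int.cast_zero, zero_mul, Real.cos_zero, Real.sin_zero, mul_one, mul_zero,
      integral_zero, mul_pow, div_pow, Real.sq_sqrt hpi.le]
    field_simp
    ring
  have hneg : ∀ n : ℤ, F (-n) = F n := by
    intro n
    simp only [hFn, Int.cast_neg, neg_mul, Real.cos_neg, Real.sin_neg, mul_neg,
      integral_neg, neg_sq]
  have hpair : ∀ k : ℕ, a (2 * k + 1) + a (2 * k + 2)
      = 2 * Real.pi * (F ((k + 1 : ℕ) : ℤ) + F (-((k + 1 : ℕ) : ℤ))) := by
    intro k
    rw [hneg]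
    simp only [ha, hFn, inner2, trig_odd, trig_even, ← mul_div_assoc, integral_div, div_pow, hsq]
    push_cast
    field_simp
    ring
  have h4 : HasSum (fun k : ℕ => a (2 * k + 1) + a (2 * k + 2)) (normSq2 f - a 0) := by
    have e : normSq2 f - a 0 = 2 * Real.pi * ((2 * Real.pi - 0)⁻¹ • normSq2 f + F 0
        - (F ((0 : ℕ) : ℤ) + F (-((0 : ℕ) : ℤ)))) := by
      rw [ha0, smul_eq_mul]
      simp only [Nat.cast_zero, neg_zero, sub_zero]
      field_simp
      ring
    simp_rw [hpair]
    rw [e]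
    exact h3.mul_left (2 * Real.pi)
  -- The sum is so far known by pairs (cosine, sine). Nonnegativity makes each half summable, so the
  -- pairs may be split and reassembled in the order of the basis.
  have ha_nn : ∀ j, 0 ≤ a j := fun j => sq_nonneg _
  have hodd : Summable (fun k : ℕ => a (2 * k + 1)) :=
    Summable.of_nonneg_of_le (fun _ => ha_nn _)
      (fun _ => le_add_of_nonneg_right (ha_nn _)) h4.summable
  have heven : Summable (fun k : ℕ => a (2 * k + 2)) :=
    Summable.of_nonneg_of_le (fun _ => ha_nn _)
      (fun _ => le_add_of_nonneg_left (ha_nn _)) h4.summable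
  have h5 : ∑' k : ℕ, a (2 * k + 1) + ∑' k : ℕ, a (2 * k + 2) = normSq2 f - a 0 := by
    rw [← h4.tsum_eq, hodd.tsum_add heven]
  have h6 : HasSum (fun k : ℕ => a (k + 1)) (normSq2 f - a 0) := by
    rw [← h5]
    exact HasSum.even_add_odd (f := fun k => a (k + 1)) hodd.hasSum heven.hasSum
  have := (hasSum_nat_add_iff (f := a) 1).1 h6
  simpa using this

/-! ### Coordinates on `S_m`, projection and residual. -/

/-- The trigonometric polynomial of `S_m` with coefficients `c`. -/
def trigPoly {m : ℕ} (c : Fin (dimS m) → ℝ) (x : ℝ) : ℝ := ∑ j, c j * trig j x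

/-- The Fourier coefficients of `f` on the basis of `S_m`. -/
def trigCoeff (m : ℕ) (f : ℝ → ℝ) (j : Fin (dimS m)) : ℝ := inner2 f (trig j)

lemma mem_trigSpace_iff {m : ℕ} {t : ℝ → ℝ} :
    t ∈ trigSpace m ↔ ∃ c : Fin (dimS m) → ℝ, t = trigPoly c := by
  have : trig '' {j | j < dimS m} = Set.range (fun j : Fin (dimS m) => trig j) := by
    ext t
    simp only [Set.mem_image, Set.mem_ofPred_eq, Set.mem_range]
    exact ⟨fun ⟨j, hj, h⟩ => ⟨⟨j, hj⟩, h⟩, fun ⟨j, h⟩ => ⟨j, j.2, h⟩⟩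
  rw [trigSpace, this, Submodule.mem_span_range_iff_exists_fun]
  refine exists_congr fun c => ?_
  have : ∑ j, c j • trig (j : ℕ) = trigPoly c := by
    ext x; simp [trigPoly]
  rw [this, eq_comm]

lemma trigPoly_mem {m : ℕ} (c : Fin (dimS m) → ℝ) : trigPoly c ∈ trigSpace m :=
  mem_trigSpace_iff.2 ⟨c, rfl⟩

lemma analyticOnNhd_trigPoly {m : ℕ} (c : Fin (dimS m) → ℝ) :
    AnalyticOnNhd ℝ (trigPoly c) Set.univ := by
  have : trigPoly c = fun x => ∑ j, c j * trig j x := rfl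
  rw [this]
  exact Finset.univ.analyticOnNhd_fun_sum fun j _ => analyticOnNhd_const.mul (analyticOnNhd_trig j)

lemma continuous_trigPoly {m : ℕ} (c : Fin (dimS m) → ℝ) : Continuous (trigPoly c) :=
  continuousOn_univ.1 (analyticOnNhd_trigPoly c).continuousOn

lemma memLp_trigPoly {m : ℕ} (c : Fin (dimS m) → ℝ) (p : ENNReal) :
    MemLp (trigPoly c) p circleVol :=
  memLp_finsetSum _ fun j _ => (memLp_trig j p).const_mul (c j)

lemma integrable_mul_of_memLp {g h : ℝ → ℝ} (hg : MemLp g 2 circleVol) (hh : MemLp h 2 circleVol) :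
    Integrable (fun x => g x * h x) circleVol :=
  hg.integrable_mul hh

lemma inner2_trigPoly {m : ℕ} {f : ℝ → ℝ} (hf : MemLp f 2 circleVol) (c : Fin (dimS m) → ℝ) :
    inner2 f (trigPoly c) = ∑ j, c j * trigCoeff m f j := by
  simp only [inner2, trigPoly, Finset.mul_sum, trigCoeff]
  rw [integral_finsetSum]
  · refine Finset.sum_congr rfl fun j _ => ?_
    rw [← integral_const_mul]
    congr 1; ext x; ring
  · intro j _
    have := (integrable_mul_of_memLp hf (memLp_trig j 2)).const_mul (c j)
    refine this.congr (Filter.Eventually.of_forall fun x => ?_)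
    simp only; ring

lemma trigCoeff_trigPoly {m : ℕ} (c : Fin (dimS m) → ℝ) : trigCoeff m (trigPoly c) = c := by
  ext j
  rw [trigCoeff, inner2_comm, inner2_trigPoly (memLp_trig _ _)]
  simp [trigCoeff, inner2_trig, Fin.val_inj]

lemma normSq2_trigPoly {m : ℕ} (c : Fin (dimS m) → ℝ) : normSq2 (trigPoly c) = ∑ j, c j ^ 2 := by
  have : normSq2 (trigPoly c) = inner2 (trigPoly c) (trigPoly c) := by
    simp only [normSq2, inner2, sq]
  rw [this, inner2_trigPoly (memLp_trigPoly _ _), trigCoeff_trigPoly]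
  simp only [sq]

lemma normSq2_nonneg (g : ℝ → ℝ) : 0 ≤ normSq2 g := integral_nonneg fun _ => sq_nonneg _

lemma normSq2_trigPoly_sub {m : ℕ} {f : ℝ → ℝ} (hf : MemLp f 2 circleVol) (c : Fin (dimS m) → ℝ) :
    normSq2 (fun x => trigPoly c x - f x)
      = ∑ j, c j ^ 2 - 2 * ∑ j, c j * trigCoeff m f j + normSq2 f := by
  rw [← normSq2_trigPoly, ← inner2_trigPoly hf, normSq2, normSq2, normSq2, inner2,
    ← integral_const_mul, ← integral_sub, ← integral_add]
  · congr 1; ext x; ring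
  · exact (memLp_trigPoly c 2).integrable_sq.sub
      ((integrable_mul_of_memLp hf (memLp_trigPoly c 2)).const_mul 2)
  · exact hf.integrable_sq
  · exact (memLp_trigPoly c 2).integrable_sq
  · exact (integrable_mul_of_memLp hf (memLp_trigPoly c 2)).const_mul 2

lemma trigCoeff_sub_trigPoly {m : ℕ} {f : ℝ → ℝ} (hf : MemLp f 2 circleVol)
    (c : Fin (dimS m) → ℝ) (j : Fin (dimS m)) :
    trigCoeff m (fun x => f x - trigPoly c x) j = trigCoeff m f j - c j := by
  have : trigCoeff m (fun x => f x - trigPoly c x) j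
      = trigCoeff m f j - trigCoeff m (trigPoly c) j := by
    simp only [trigCoeff, inner2, sub_mul]
    rw [integral_sub (integrable_mul_of_memLp hf (memLp_trig _ 2))
      (integrable_mul_of_memLp (memLp_trigPoly _ 2) (memLp_trig _ 2))]
  rw [this, trigCoeff_trigPoly]

lemma IsProjection.eq_trigPoly {m : ℕ} {f g : ℝ → ℝ} (hf : MemLp f 2 circleVol)
    (h : IsProjection m f g) : g = trigPoly (trigCoeff m f) := by
  obtain ⟨c, rfl⟩ := mem_trigSpace_iff.1 h.1
  congr 1
  ext j
  have h1 := h.2 (trig j) (Submodule.subset_span ⟨j, j.2, rfl⟩)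
  have h2 := trigCoeff_sub_trigPoly hf c j
  rw [trigCoeff, h1] at h2
  linarith

/-- The squared distance from `f` to `S_m` is the sum of the squares of the remaining
coefficients. -/
lemma hasSum_residual {m : ℕ} {f : ℝ → ℝ} (hf : MemLp f 2 circleVol) :
    HasSum (fun j => inner2 f (trig (j + dimS m)) ^ 2)
      (normSq2 (fun x => trigPoly (trigCoeff m f) x - f x)) := by
  have h := (hasSum_nat_add_iff' (dimS m)).2 (hasSum_sq_inner2_trig hf)
  have e : normSq2 (fun x => trigPoly (trigCoeff m f) x - f x)
      = normSq2 f - ∑ j ∈ Finset.range (dimS m), inner2 f (trig j) ^ 2 := by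
    rw [normSq2_trigPoly_sub hf, Finset.sum_range]
    simp only [trigCoeff, ← sq]
    ring
  rw [e]
  exact h

/-! ### Arcs and the empirical coverage -/

/-- If `l ≤ u`, the half-lines `[l, ∞)` and `(-∞, u]` cover everything and overlap in the arc. If `u
< l`, they are disjoint and their union, within the circle, is the arc. The formula reduces
uniformity over arcs to uniformity over half-lines. -/
lemma indicator_arc (l u : ℝ) {x : ℝ} (hx : x ∈ circle) :
    (arc l u).indicator (fun _ => (1 : ℝ)) x
      = (Set.Ici l).indicator (fun _ => 1) x + (Set.Iic u).indicator (fun _ => 1) x - 1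
        + (if u < l then 1 else 0) := by
  by_cases h : l ≤ u
  · have h' : ¬ u < l := not_lt.2 h
    rw [arc, if_pos h, if_neg h']
    simp only [Set.indicator_apply, Set.mem_Ici, Set.mem_Iic, Set.mem_Icc]
    by_cases h1 : l ≤ x <;> by_cases h2 : x ≤ u <;> simp [h1, h2]
    linarith
  · have h' : u < l := not_le.1 h
    rw [arc, if_neg h, if_pos h']
    simp only [Set.indicator_apply, Set.mem_Ici, Set.mem_Iic]
    by_cases h1 : l ≤ x <;> by_cases h2 : x ≤ u
    · linarith
    · simp [h1, h2, hx]
    · simp [h1, h2, hx]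
    · simp [not_le.1 h1, not_le.1 h2, h1, h2]

lemma measurableSet_arc_prod : MeasurableSet {q : (ℝ × ℝ) × ℝ | q.2 ∈ arc q.1.1 q.1.2} := by
  have : {q : (ℝ × ℝ) × ℝ | q.2 ∈ arc q.1.1 q.1.2}
      = ({q : (ℝ × ℝ) × ℝ | q.1.1 ≤ q.1.2} ∩ ({q | q.1.1 ≤ q.2} ∩ {q | q.2 ≤ q.1.2}))
        ∪ ({q : (ℝ × ℝ) × ℝ | q.1.1 ≤ q.1.2}ᶜ
          ∩ (Prod.snd ⁻¹' circle \ ({q | q.1.2 < q.2} ∩ {q | q.2 < q.1.1}))) := by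
    ext q
    by_cases h : q.1.1 ≤ q.1.2 <;> simp [arc, h]
  rw [this]
  have h1 : MeasurableSet {q : (ℝ × ℝ) × ℝ | q.1.1 ≤ q.1.2} :=
    measurableSet_le (by fun_prop) (by fun_prop)
  refine (h1.inter ((measurableSet_le (by fun_prop) (by fun_prop)).inter
    (measurableSet_le (by fun_prop) (by fun_prop)))).union (h1.compl.inter
    ((measurable_snd measurableSet_circle).diff
      ((measurableSet_lt (by fun_prop) (by fun_prop)).inter
    (measurableSet_lt (by fun_prop) (by fun_prop)))))

lemma measurableSet_arc (l u : ℝ) : MeasurableSet (arc l u) :=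
  measurableSet_arc_prod.preimage (measurable_prodMk_left (x := (l, u)))

/-- The proportion of observation windows that cover `x`. -/
def empCover {n : ℕ} (o : Fin n → Obs) (x : ℝ) : ℝ :=
  (1 / (n : ℝ)) * ∑ i, (arc (o i).left (o i).right).indicator (fun _ => 1) x

lemma measurable_empCover {n : ℕ} (o : Fin n → Obs) : Measurable (empCover o) := by
  refine (Finset.measurable_sum _ fun i _ => ?_).const_mul _
  exact measurable_const.indicator (measurableSet_arc _ _)

lemma empCover_nonneg {n : ℕ} (o : Fin n → Obs) (x : ℝ) : 0 ≤ empCover o x :=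
  mul_nonneg (by positivity) (Finset.sum_nonneg fun i _ => Set.indicator_nonneg (by simp) _)

lemma empCover_le_one {n : ℕ} (o : Fin n → Obs) (x : ℝ) : empCover o x ≤ 1 := by
  rcases Nat.eq_zero_or_pos n with rfl | hn
  · simp [empCover]
  · have : ∑ i, (arc (o i).left (o i).right).indicator (fun _ => (1 : ℝ)) x ≤ ∑ i : Fin n, 1 :=
      Finset.sum_le_sum fun i _ => Set.indicator_le_self' (by simp) x
    rw [empCover, one_div, inv_mul_le_iff₀ (by positivity)]
    simpa using this

lemma abs_empCover_le_one {n : ℕ} (o : Fin n → Obs) (x : ℝ) : |empCover o x| ≤ 1 := by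
  rw [abs_of_nonneg (empCover_nonneg o x)]; exact empCover_le_one o x

lemma Integrable.empCover_mul {n : ℕ} (o : Fin n → Obs) {g : ℝ → ℝ} (hg : Integrable g circleVol) :
    Integrable (fun x => empCover o x * g x) circleVol :=
  hg.bdd_mul (c := 1) (measurable_empCover o).aestronglyMeasurable
    (Filter.Eventually.of_forall (abs_empCover_le_one o))

lemma integral_empCover_mul {n : ℕ} (o : Fin n → Obs) {g : ℝ → ℝ} (hg : Integrable g circleVol) :
    ∫ x, empCover o x * g x ∂circleVol
      = (1 / (n : ℝ)) * ∑ i, ∫ x, (arc (o i).left (o i).right).indicator g x ∂circleVol := by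
  have h : ∀ x, empCover o x * g x
      = (1 / (n : ℝ)) * ∑ i, (arc (o i).left (o i).right).indicator g x := by
    intro x
    rw [empCover, mul_assoc, Finset.sum_mul]
    congr 1
    refine Finset.sum_congr rfl fun i _ => ?_
    by_cases hx : x ∈ arc (o i).left (o i).right <;> simp [hx]
  simp_rw [h]
  rw [integral_const_mul, integral_finsetSum _ fun i _ => hg.indicator (measurableSet_arc _ _)]

/-! ### The contrast as a quadratic form and its minimizer. -/

/-- The empirical Gram matrix of the basis of `S_m`. -/
def gram {n : ℕ} (o : Fin n → Obs) (m : ℕ) : Matrix (Fin (dimS m)) (Fin (dimS m)) ℝ :=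
  Matrix.of fun j k => ∫ x, empCover o x * (trig j x * trig k x) ∂circleVol

/-- The empirical coefficients of the linear part of the contrast. -/
def empCoeff {n : ℕ} (o : Fin n → Obs) (m : ℕ) (j : Fin (dimS m)) : ℝ :=
  (1 / (n : ℝ)) * ∑ i, (o i).ind * trig j (o i).value

lemma gram_isSymm {n : ℕ} (o : Fin n → Obs) (m : ℕ) : (gram o m).transpose = gram o m := by
  ext j k
  simp only [gram, Matrix.transpose_apply, Matrix.of_apply]
  congr 1; ext x; ring

lemma gram_mulVec {n : ℕ} (o : Fin n → Obs) {m : ℕ} (d : Fin (dimS m) → ℝ) (j : Fin (dimS m)) :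
    (gram o m).mulVec d j = ∫ x, empCover o x * (trig j x * trigPoly d x) ∂circleVol := by
  simp only [Matrix.mulVec, dotProduct, gram, Matrix.of_apply, trigPoly, Finset.mul_sum]
  rw [integral_finsetSum]
  · refine Finset.sum_congr rfl fun k _ => ?_
    rw [← integral_mul_const]
    congr 1; ext x; ring
  · intro k _
    exact Integrable.empCover_mul o (integrable_of_continuous
      ((continuous_trig _).mul (continuous_const.mul (continuous_trig _))))

lemma dotProduct_gram {n : ℕ} (o : Fin n → Obs) {m : ℕ} (c d : Fin (dimS m) → ℝ) :
    c ⬝ᵥ (gram o m).mulVec d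
      = ∫ x, empCover o x * (trigPoly c x * trigPoly d x) ∂circleVol := by
  simp only [dotProduct, gram_mulVec]
  simp only [trigPoly.eq_def c, Finset.mul_sum, Finset.sum_mul]
  rw [integral_finsetSum]
  · refine Finset.sum_congr rfl fun k _ => ?_
    rw [← integral_const_mul]
    congr 1; ext x; ring
  · intro k _
    exact Integrable.empCover_mul o (integrable_of_continuous
      ((continuous_const.mul (continuous_trig _)).mul (continuous_trigPoly _)))

lemma contrast_trigPoly {n : ℕ} (o : Fin n → Obs) {m : ℕ} (c : Fin (dimS m) → ℝ) :
    contrast o (trigPoly c)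
      = c ⬝ᵥ (gram o m).mulVec c - 2 * (c ⬝ᵥ empCoeff o m) := by
  have h1 : c ⬝ᵥ empCoeff o m = (1 / (n : ℝ)) * ∑ i, (o i).ind * trigPoly c (o i).value := by
    simp only [dotProduct, empCoeff, trigPoly, Finset.mul_sum]
    rw [Finset.sum_comm]
    refine Finset.sum_congr rfl fun i _ => Finset.sum_congr rfl fun j _ => ?_
    ring
  have hi : Integrable (fun x => trigPoly c x * trigPoly c x) circleVol :=
    integrable_of_continuous ((continuous_trigPoly c).mul (continuous_trigPoly c))
  rw [dotProduct_gram, h1, integral_empCover_mul o hi, contrast, Finset.sum_sub_distrib, mul_sub]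
  simp only [← sq, mul_assoc, ← Finset.mul_sum]
  ring

lemma empCover_ae_pos_interval {n : ℕ} (o : Fin n → Obs) (i : Fin n)
    (hl : (o i).left ∈ circle) (hu : (o i).right ∈ circle) (hne : (o i).left ≠ (o i).right) :
    ∃ p q : ℝ, p < q ∧ Set.Ioo p q ⊆ circle ∧ ∀ x ∈ Set.Ioo p q, 0 < empCover o x := by
  have key : ∃ p q : ℝ, p < q ∧ Set.Ioo p q ⊆ circle ∧
      Set.Ioo p q ⊆ arc (o i).left (o i).right := by
    rcases lt_or_gt_of_ne hne with h | h
    · refine ⟨_, _, h, fun x hx => ⟨hl.1.trans hx.1.le, hx.2.trans hu.2⟩, fun x hx => ?_⟩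
      rw [arc, if_pos h.le]; exact ⟨hx.1.le, hx.2.le⟩
    -- An arc that wraps around contains `(l, 2π)`, which is nonempty because `l < 2π`.
    · have hc : Set.Ioo (o i).left (2 * Real.pi) ⊆ circle := fun x hx => ⟨hl.1.trans hx.1.le, hx.2⟩
      refine ⟨_, _, hl.2, hc, fun x hx => ?_⟩
      rw [arc, if_neg (not_le.2 h)]
      exact ⟨hc hx, fun hx' => lt_asymm hx'.2 hx.1⟩
  obtain ⟨p, q, hpq, h1, h2⟩ := key
  refine ⟨p, q, hpq, h1, fun x hx => ?_⟩
  have hn : 0 < n := i.pos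
  refine mul_pos (by positivity) (Finset.sum_pos' (fun i _ => Set.indicator_nonneg (by simp) _)
    ⟨i, Finset.mem_univ _, ?_⟩)
  simp [Set.indicator_of_mem (h2 hx)]

/-- The Gram matrix is positive definite as soon as one window is a non-degenerate arc. -/
lemma gram_pos {n : ℕ} (o : Fin n → Obs) {m : ℕ} (i : Fin n)
    (hl : (o i).left ∈ circle) (hu : (o i).right ∈ circle) (hne : (o i).left ≠ (o i).right)
    {d : Fin (dimS m) → ℝ} (hd : d ≠ 0) : 0 < d ⬝ᵥ (gram o m).mulVec d := by
  rw [dotProduct_gram]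
  have hnn : ∀ x, 0 ≤ empCover o x * (trigPoly d x * trigPoly d x) := fun x =>
    mul_nonneg (empCover_nonneg o x) (mul_self_nonneg _)
  refine lt_of_le_of_ne (integral_nonneg hnn) fun h0 => hd ?_
  have hi := Integrable.empCover_mul o
    (integrable_of_continuous ((continuous_trigPoly d).mul (continuous_trigPoly d)))
  have hae := (integral_eq_zero_iff_of_nonneg hnn hi).1 h0.symm
  obtain ⟨p, q, hpq, hc, hpos⟩ := empCover_ae_pos_interval o i hl hu hne
  have hae' : ∀ᵐ x ∂volume.restrict (Set.Ioo p q), trigPoly d x = 0 := by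
    have hae2 := ae_restrict_of_ae_restrict_of_subset hc hae
    filter_upwards [hae2, ae_restrict_mem measurableSet_Ioo] with x hx hxm
    have := hpos x hxm
    simpa [this.ne'] using hx
  have heq : Set.EqOn (trigPoly d) (fun _ => 0) (Set.Ioo p q) :=
    Measure.eqOn_open_of_ae_eq hae' isOpen_Ioo (continuous_trigPoly d).continuousOn
      continuousOn_const
  have hzero : trigPoly d = fun _ => 0 := by
    refine (analyticOnNhd_trigPoly d).eq_of_eventuallyEq analyticOnNhd_const
      (z₀ := (p + q) / 2) ?_
    filter_upwards [Ioo_mem_nhds (show p < (p + q) / 2 by linarith)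
      (show (p + q) / 2 < q by linarith)] with x hx using heq hx
  have h3 : ∑ j, d j ^ 2 = 0 := by
    rw [← normSq2_trigPoly, hzero]; simp [normSq2]
  ext j
  simpa using (Finset.sum_eq_zero_iff_of_nonneg fun j _ => sq_nonneg _).1 h3 j (Finset.mem_univ _)

/-- The coefficients of the least-squares estimator, when the Gram matrix is invertible. -/
def lsCoeff {n : ℕ} (o : Fin n → Obs) (m : ℕ) : Fin (dimS m) → ℝ :=
  (gram o m)⁻¹.mulVec (empCoeff o m)

lemma gram_mulVec_lsCoeff {n : ℕ} {o : Fin n → Obs} {m : ℕ}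
    (hpos : ∀ d : Fin (dimS m) → ℝ, d ≠ 0 → 0 < d ⬝ᵥ (gram o m).mulVec d) :
    (gram o m).mulVec (lsCoeff o m) = empCoeff o m := by
  have hunit : IsUnit (gram o m) := by
    rw [← Matrix.mulVec_injective_iff_isUnit]
    intro c d hcd
    by_contra hne
    have := hpos (c - d) (sub_ne_zero.2 hne)
    rw [Matrix.mulVec_sub, hcd] at this
    simp at this
  rw [lsCoeff, Matrix.mulVec_mulVec,
    Matrix.mul_nonsing_inv _ ((Matrix.isUnit_iff_isUnit_det _).1 hunit), Matrix.one_mulVec]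

/-- Completing the square around the solution of the normal equations; the cross term is handled by
the symmetry of `gram`. -/
lemma contrast_sub_contrast_lsCoeff {n : ℕ} {o : Fin n → Obs} {m : ℕ}
    (hpos : ∀ d : Fin (dimS m) → ℝ, d ≠ 0 → 0 < d ⬝ᵥ (gram o m).mulVec d)
    (c : Fin (dimS m) → ℝ) :
    contrast o (trigPoly c) - contrast o (trigPoly (lsCoeff o m))
      = (c - lsCoeff o m) ⬝ᵥ (gram o m).mulVec (c - lsCoeff o m) := by
  have hG := gram_mulVec_lsCoeff hpos
  have hsym : lsCoeff o m ⬝ᵥ (gram o m).mulVec c = c ⬝ᵥ empCoeff o m := by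
    rw [Matrix.dotProduct_mulVec, ← Matrix.mulVec_transpose, gram_isSymm, hG, dotProduct_comm]
  rw [contrast_trigPoly, contrast_trigPoly, Matrix.mulVec_sub, hG, sub_dotProduct,
    dotProduct_sub, dotProduct_sub, hsym]
  ring

lemma isLeastSquares_iff {n : ℕ} {o : Fin n → Obs} {m : ℕ}
    (hpos : ∀ d : Fin (dimS m) → ℝ, d ≠ 0 → 0 < d ⬝ᵥ (gram o m).mulVec d) (t : ℝ → ℝ) :
    IsLeastSquares o m t ↔ t = trigPoly (lsCoeff o m) := by
  constructor
  · rintro ⟨ht, hmin⟩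
    obtain ⟨c, rfl⟩ := mem_trigSpace_iff.1 ht
    have h1 := hmin _ (trigPoly_mem (lsCoeff o m))
    have h2 := contrast_sub_contrast_lsCoeff hpos c
    by_contra hne
    have hcd : c - lsCoeff o m ≠ 0 := fun h => hne (by rw [sub_eq_zero.1 h])
    have := hpos _ hcd
    linarith
  · rintro rfl
    refine ⟨trigPoly_mem _, fun s hs => ?_⟩
    obtain ⟨c, rfl⟩ := mem_trigSpace_iff.1 hs
    have h2 := contrast_sub_contrast_lsCoeff hpos c
    by_cases hcd : c - lsCoeff o m = 0
    · rw [sub_eq_zero.1 hcd]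
    · have := hpos _ hcd
      linarith

lemma lsEstimator_eq {n : ℕ} {o : Fin n → Obs} {m : ℕ}
    (hpos : ∀ d : Fin (dimS m) → ℝ, d ≠ 0 → 0 < d ⬝ᵥ (gram o m).mulVec d) :
    lsEstimator o m = trigPoly (lsCoeff o m) := by
  have h : ∃ t, IsLeastSquares o m t := ⟨_, (isLeastSquares_iff hpos _).2 rfl⟩
  rw [lsEstimator, dif_pos h]
  exact (isLeastSquares_iff hpos _).1 h.choose_spec

open Classical in
/-- The squared error of the truncated estimator in terms of the coefficients. -/
lemma normSq2_truncEstimator_sub {n : ℕ} {o : Fin n → Obs} {m : ℕ} {f : ℝ → ℝ}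
    (hf : MemLp f 2 circleVol)
    (hpos : ∀ d : Fin (dimS m) → ℝ, d ≠ 0 → 0 < d ⬝ᵥ (gram o m).mulVec d) :
    normSq2 (fun x => truncEstimator o m x - f x)
      = if ∑ j, lsCoeff o m j ^ 2 ≤ (n : ℝ) ^ 2 then
          ∑ j, lsCoeff o m j ^ 2 - 2 * ∑ j, lsCoeff o m j * trigCoeff m f j + normSq2 f
        else normSq2 f := by
  rw [truncEstimator, lsEstimator_eq hpos, normSq2_trigPoly]
  split_ifs with h
  · exact normSq2_trigPoly_sub hf _
  · simp [normSq2]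

/-! ### Uniform lower deviations of empirical distribution functions. -/

section Deviation

/-- The empirical frequency of `A` in the sample `Z`. -/
def empFreq {E Ω : Type*} {n : ℕ} (Z : Fin n → Ω → E) (A : Set E) (ω : Ω) : ℝ :=
  (1 / (n : ℝ)) * ∑ i, A.indicator (fun _ => 1) (Z i ω)

lemma empFreq_nonneg {E Ω : Type*} {n : ℕ} (Z : Fin n → Ω → E) (A : Set E) (ω : Ω) :
    0 ≤ empFreq Z A ω :=
  mul_nonneg (by positivity) (Finset.sum_nonneg fun _ _ => Set.indicator_nonneg (by simp) _)

lemma empFreq_mono {E Ω : Type*} {n : ℕ} (Z : Fin n → Ω → E) {A B : Set E} (h : A ⊆ B) (ω : Ω) :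
    empFreq Z A ω ≤ empFreq Z B ω := by
  refine mul_le_mul_of_nonneg_left (Finset.sum_le_sum fun i _ => ?_) (by positivity)
  exact Set.indicator_le_indicator_of_subset h (fun _ => zero_le_one) _

variable {E Ω : Type*} [MeasurableSpace E] [MeasurableSpace Ω] {P : Measure Ω}
  {ν : Measure E} {n : ℕ} {Z : Fin n → Ω → E}

lemma measurable_empFreq (hm : ∀ i, Measurable (Z i)) {A : Set E} (hA : MeasurableSet A) :
    Measurable (empFreq Z A) :=
  (Finset.measurable_sum _ fun i _ =>
    (measurable_const.indicator hA).comp (hm i)).const_mul _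

/-- Hoeffding's inequality for an empirical frequency. -/
lemma measure_empFreq_le [IsProbabilityMeasure P] (hn : 0 < n) (hm : ∀ i, Measurable (Z i))
    (hlaw : ∀ i, P.map (Z i) = ν)
    (hind : iIndepFun Z P) {A : Set E} (hA : MeasurableSet A) {ε : ℝ} (hε : 0 ≤ ε) :
    P.real {ω | empFreq Z A ω ≤ ν.real A - ε} ≤ Real.exp (-(2 * n * ε ^ 2)) := by
  have hn' : (0 : ℝ) < n := by exact_mod_cast hn
  -- A lower deviation of the frequency is an upper deviation of minus the indicator, which lies in
  -- `[-1, 0]` and so is sub-Gaussian with variance proxy `1 / 4` after centring.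
  set g : E → ℝ := fun z => -A.indicator (fun _ => 1) z with hg
  have hgm : Measurable g := (measurable_const.indicator hA).neg
  have hmean : ∀ i, ∫ ω, g (Z i ω) ∂P = -ν.real A := by
    intro i
    rw [← integral_map (hm i).aemeasurable hgm.aestronglyMeasurable, hlaw i, integral_neg]
    congr 1
    exact integral_indicator_one (μ := ν) hA
  have hsub : ∀ i ∈ Finset.univ, HasSubgaussianMGF (fun ω => g (Z i ω) + ν.real A)
      ((‖(0 : ℝ) - (-1)‖₊ / 2) ^ 2) P := by
    intro i _
    have h := hasSubgaussianMGF_of_mem_Icc (μ := P) (X := fun ω => g (Z i ω)) (a := -1) (b := 0)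
      (hgm.comp (hm i)).aemeasurable (Filter.Eventually.of_forall fun ω => ?_)
    · simp only [hmean i, sub_neg_eq_add] at h
      simpa using h
    · by_cases hz : Z i ω ∈ A <;> simp [hg, hz]
  have hind' : iIndepFun (fun i ω => g (Z i ω) + ν.real A) P :=
    hind.comp (fun _ z => g z + ν.real A) fun _ => hgm.add_const _
  have h := HasSubgaussianMGF.measure_sum_ge_le_of_iIndepFun hind' hsub
    (ε := n * ε) (by positivity)
  refine (measureReal_mono ?_).trans (h.trans_eq ?_)
  · intro ω hω
    have hω' : empFreq Z A ω ≤ ν.real A - ε := hω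
    rw [empFreq, one_div, inv_mul_le_iff₀ hn'] at hω'
    show n * ε ≤ ∑ i, (g (Z i ω) + ν.real A)
    rw [Finset.sum_add_distrib]
    simp only [hg, Finset.sum_neg_distrib, Finset.sum_const, Finset.card_univ, Fintype.card_fin,
      nsmul_eq_mul]
    linarith
  · congr 1
    simp
    field_simp

/-- The infimum of the points where the distribution function reaches `c`; right continuity shows
that the level is reached there. If the level is never reached, any `q` will do. -/
lemma exists_quantile (μ : Measure ℝ) [IsProbabilityMeasure μ] {c : ℝ} (hc : 0 < c) :
    ∃ q, ∀ x, c ≤ cdf μ x → c ≤ cdf μ q ∧ q ≤ x := by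
  by_cases hne : ∃ x, c ≤ cdf μ x
  · set S : Set ℝ := {y | c ≤ cdf μ y} with hS
    have hbdd : BddBelow S := by
      have := (tendsto_cdf_atBot μ).eventually (gt_mem_nhds hc)
      obtain ⟨b, hb⟩ := this.exists
      refine ⟨b, fun y hy => ?_⟩
      by_contra hlt
      have hy' : c ≤ cdf μ y := hy
      have := monotone_cdf μ (not_le.1 hlt).le
      linarith
    refine ⟨sInf S, fun x hx => ⟨?_, csInf_le hbdd hx⟩⟩
    have hcont : Filter.Tendsto (cdf μ) (nhdsWithin (sInf S) (Set.Ioi (sInf S)))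
        (nhds (cdf μ (sInf S))) :=
      ((cdf μ).right_continuous _).mono_left (nhdsWithin_mono _ Set.Ioi_subset_Ici_self)
    refine ge_of_tendsto hcont ?_
    filter_upwards [self_mem_nhdsWithin] with y hy
    obtain ⟨s, hs, hsy⟩ := exists_lt_of_csInf_lt hne hy
    have hs' : c ≤ cdf μ s := hs
    exact hs'.trans (monotone_cdf μ hsy.le)
  · exact ⟨0, fun x hx => absurd ⟨x, hx⟩ hne⟩

/-- Uniform lower deviation of an empirical distribution function: outside an event of
exponentially small probability it stays above the distribution function minus `2 ε`. -/
lemma exists_event_empFreq [IsProbabilityMeasure ν] [IsProbabilityMeasure P] (hn : 0 < n)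
    (hm : ∀ i, Measurable (Z i))
    (hlaw : ∀ i, P.map (Z i) = ν) (hind : iIndepFun Z P) {g : E → ℝ} (hg : Measurable g) {ε : ℝ}
    (hε : 0 < ε) :
    ∃ B : Set Ω, MeasurableSet B ∧
      P.real B ≤ (⌈1 / ε⌉₊ + 1) * Real.exp (-(2 * n * ε ^ 2)) ∧
      ∀ ω ∉ B, ∀ x, ν.real {z | g z ≤ x} - 2 * ε ≤ empFreq Z {z | g z ≤ x} ω := by
  have : IsProbabilityMeasure (ν.map g) := Measure.isProbabilityMeasure_map hg.aemeasurable
  have hcdf : ∀ x, cdf (ν.map g) x = ν.real {z | g z ≤ x} := by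
    intro x
    rw [cdf_eq_real, map_measureReal_apply hg measurableSet_Iic]
    rfl
  have hmeas : ∀ x, MeasurableSet {z | g z ≤ x} := fun x => hg measurableSet_Iic
  have hq : ∀ k : ℕ, ∃ q, 0 < k → ∀ x, k * ε ≤ cdf (ν.map g) x →
      k * ε ≤ cdf (ν.map g) q ∧ q ≤ x := by
    intro k
    rcases Nat.eq_zero_or_pos k with rfl | hk
    · exact ⟨0, fun h => absurd h (lt_irrefl _)⟩
    · obtain ⟨q, hq⟩ := exists_quantile (ν.map g) (c := k * ε) (by positivity)
      exact ⟨q, fun _ => hq⟩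
  choose q hq using hq
  set B : ℕ → Set Ω := fun k =>
    {ω | empFreq Z {z | g z ≤ q k} ω ≤ ν.real {z | g z ≤ q k} - ε} with hB
  refine ⟨⋃ k ∈ Finset.range (⌈1 / ε⌉₊ + 1), B k, ?_, ?_, ?_⟩
  · exact Finset.measurableSet_biUnion _ fun k _ =>
      measurableSet_le (measurable_empFreq hm (hmeas _)) measurable_const
  · refine (measureReal_biUnion_finset_le _ _).trans ?_
    refine (Finset.sum_le_sum fun k _ =>
      measure_empFreq_le hn hm hlaw hind (hmeas (q k)) hε.le).trans_eq ?_
    simp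
  · intro ω hω x
    simp only [Set.mem_iUnion, not_exists] at hω
    -- Compare with the quantile at the grid level `k ε` just below `F(x)`: one `ε` is lost to
    -- rounding and one to Hoeffding at that quantile. For `k = 0` the claim is trivial since `F(x)
    -- < ε`.
    set k := ⌊ν.real {z | g z ≤ x} / ε⌋₊ with hk
    have hGx : 0 ≤ ν.real {z | g z ≤ x} := measureReal_nonneg
    have hk1 : k * ε ≤ ν.real {z | g z ≤ x} := by
      rw [← le_div_iff₀ hε]; exact Nat.floor_le (by positivity)
    have hk2 : ν.real {z | g z ≤ x} < (k + 1) * ε := by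
      rw [← div_lt_iff₀ hε]; exact Nat.lt_floor_add_one _
    rcases Nat.eq_zero_or_pos k with h0 | hpos
    · rw [h0] at hk2
      have := empFreq_nonneg Z {z | g z ≤ x} ω
      norm_num at hk2
      linarith
    · have hkr : k ∈ Finset.range (⌈1 / ε⌉₊ + 1) := by
        rw [Finset.mem_range, Nat.lt_add_one_iff]
        refine (Nat.floor_mono (div_le_div_of_nonneg_right measureReal_le_one hε.le)).trans
          (Nat.floor_le_ceil _)
      have h1 := hω k hkr
      have h1' : ν.real {z | g z ≤ q k} - ε < empFreq Z {z | g z ≤ q k} ω := not_le.1 h1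
      obtain ⟨h2, h3⟩ := hq k hpos x (by rw [hcdf]; exact hk1)
      rw [hcdf] at h2
      have h4 := empFreq_mono Z (A := {z | g z ≤ q k}) (B := {z | g z ≤ x})
        (fun z hz => le_trans hz h3) ω
      linarith

end Deviation

/-! ### The empirical coverage is uniformly bounded below. -/

section Coverage

variable {Ω : Type*} [MeasurableSpace Ω] {P : Measure Ω}
  {f : ℝ → ℝ} {ν : Measure (ℝ × ℝ)} {n : ℕ} {X L U : Fin n → Ω → ℝ}

lemma IsCensoredSample.measurable_LU (h : IsCensoredSample P f ν X L U) (i : Fin n) :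
    Measurable fun ω => (L i ω, U i ω) :=
  (h.measurable_L i).prodMk (h.measurable_U i)

lemma IsCensoredSample.indep_LU (h : IsCensoredSample P f ν X L U) :
    iIndepFun (fun i ω => (L i ω, U i ω)) P :=
  h.indep_triplets.comp (fun _ z => z.2) fun _ => measurable_snd

lemma IsCensoredSample.isProbabilityMeasure [IsProbabilityMeasure P]
    (h : IsCensoredSample P f ν X L U) (hn : 0 < n) :
    IsProbabilityMeasure ν := by
  rw [← h.law_LU ⟨0, hn⟩]
  exact Measure.isProbabilityMeasure_map (h.measurable_LU _).aemeasurable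

/-- Integrates `indicator_arc` over windows. The event `x ≤ u` is written `-u ≤ -x` so that it too
is a sublevel set, as `exists_event_empFreq` requires. -/
lemma sigma_eq [IsProbabilityMeasure ν] {x : ℝ} (hx : x ∈ circle) :
    sigma ν x = ν.real {p | p.1 ≤ x} + ν.real {p | -p.2 ≤ -x} - 1 + ν.real {p | p.2 < p.1} := by
  have m0 : MeasurableSet {p : ℝ × ℝ | x ∈ arc p.1 p.2} :=
    measurableSet_arc_prod.preimage measurable_prodMk_right
  have m1 : MeasurableSet {p : ℝ × ℝ | p.1 ≤ x} := measurableSet_le (by fun_prop) (by fun_prop)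
  have m2 : MeasurableSet {p : ℝ × ℝ | -p.2 ≤ -x} := measurableSet_le (by fun_prop) (by fun_prop)
  have m3 : MeasurableSet {p : ℝ × ℝ | p.2 < p.1} := measurableSet_lt (by fun_prop) (by fun_prop)
  have i1 : ∀ {A : Set (ℝ × ℝ)}, MeasurableSet A → Integrable (A.indicator (1 : ℝ × ℝ → ℝ)) ν :=
    fun hA => (integrable_const (1 : ℝ)).indicator hA
  rw [sigma, ← integral_indicator_one m0, ← integral_indicator_one m1, ← integral_indicator_one m2,
    ← integral_indicator_one m3]
  have e1 : ∀ a b c : ℝ, a + b - 1 + c = a + b - ∫ _, (1 : ℝ) ∂ν + c := by simp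
  have i12 : Integrable (fun p => {p : ℝ × ℝ | p.1 ≤ x}.indicator (1 : ℝ × ℝ → ℝ) p
      + {p : ℝ × ℝ | -p.2 ≤ -x}.indicator (1 : ℝ × ℝ → ℝ) p) ν := (i1 m1).add (i1 m2)
  have i123 : Integrable (fun p => {p : ℝ × ℝ | p.1 ≤ x}.indicator (1 : ℝ × ℝ → ℝ) p
      + {p : ℝ × ℝ | -p.2 ≤ -x}.indicator (1 : ℝ × ℝ → ℝ) p - 1) ν := i12.sub (integrable_const _)
  rw [e1, ← integral_add (i1 m1) (i1 m2), ← integral_sub i12 (integrable_const _),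
    ← integral_add i123 (i1 m3)]
  congr 1
  ext p
  have h1 := indicator_arc p.1 p.2 hx
  have h2 : Set.indicator {p : ℝ × ℝ | x ∈ arc p.1 p.2} (1 : ℝ × ℝ → ℝ) p
      = (arc p.1 p.2).indicator (fun _ => 1) x := by
    by_cases hp : x ∈ arc p.1 p.2 <;> simp [hp]
  rw [h2, h1]
  simp [Set.indicator_apply]

lemma empCover_eq {Ω : Type*} {n : ℕ} {L U : Fin n → Ω → ℝ} (X : Fin n → Ω → ℝ)
    (hn : 0 < n) (ω : Ω) {x : ℝ} (hx : x ∈ circle) :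
    empCover (sampleObs X L U ω) x
      = empFreq (fun i ω => (L i ω, U i ω)) {p | p.1 ≤ x} ω
        + empFreq (fun i ω => (L i ω, U i ω)) {p | -p.2 ≤ -x} ω - 1
        + empFreq (fun i ω => (L i ω, U i ω)) {p | p.2 < p.1} ω := by
  have hn' : (n : ℝ) ≠ 0 := by exact_mod_cast hn.ne'
  have h1 : (1 : ℝ) = (1 / (n : ℝ)) * ∑ i : Fin n, 1 := by simp [hn']
  have h2 : ∀ i, (arc (L i ω) (U i ω)).indicator (fun _ => (1 : ℝ)) x
      = Set.indicator {p : ℝ × ℝ | p.1 ≤ x} (fun _ => 1) (L i ω, U i ω)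
        + Set.indicator {p : ℝ × ℝ | -p.2 ≤ -x} (fun _ => 1) (L i ω, U i ω) - 1
        + Set.indicator {p : ℝ × ℝ | p.2 < p.1} (fun _ => 1) (L i ω, U i ω) := by
    intro i
    rw [indicator_arc _ _ hx]
    simp [Set.indicator_apply]
  simp only [empCover, empFreq, sampleObs, observe]
  simp_rw [h2]
  rw [Finset.sum_add_distrib, Finset.sum_sub_distrib, Finset.sum_add_distrib, mul_add, mul_sub,
    mul_add, ← h1]

/-- Outside an event of exponentially small probability, the empirical coverage is uniformly
above `σ - 5 ε`. -/
lemma exists_event_empCover [IsProbabilityMeasure P]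
    (h : IsCensoredSample P f ν X L U) (hn : 0 < n) {ε : ℝ} (hε : 0 < ε) :
    ∃ B : Set Ω, MeasurableSet B ∧
      P.real B ≤ (2 * ⌈1 / ε⌉₊ + 3) * Real.exp (-(2 * n * ε ^ 2)) ∧
      ∀ ω ∉ B, ∀ x ∈ circle, sigma ν x - 5 * ε ≤ empCover (sampleObs X L U ω) x := by
  have := h.isProbabilityMeasure hn
  obtain ⟨B1, m1, p1, b1⟩ := exists_event_empFreq hn h.measurable_LU h.law_LU h.indep_LU
    measurable_fst hε
  obtain ⟨B2, m2, p2, b2⟩ := exists_event_empFreq hn h.measurable_LU h.law_LU h.indep_LU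
    measurable_snd.neg hε
  have m3 : MeasurableSet {p : ℝ × ℝ | p.2 < p.1} := measurableSet_lt (by fun_prop) (by fun_prop)
  have p3 := measure_empFreq_le hn h.measurable_LU h.law_LU h.indep_LU m3 hε.le
  set B3 : Set Ω := {ω | empFreq (fun i ω => (L i ω, U i ω)) {p : ℝ × ℝ | p.2 < p.1} ω
    ≤ ν.real {p : ℝ × ℝ | p.2 < p.1} - ε} with hB3
  have mB3 : MeasurableSet B3 :=
    measurableSet_le (measurable_empFreq h.measurable_LU m3) measurable_const
  refine ⟨B1 ∪ B2 ∪ B3, (m1.union m2).union mB3, ?_, fun ω hω x hx => ?_⟩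
  · have h1 := measureReal_union_le (μ := P) (B1 ∪ B2) B3
    have h2 := measureReal_union_le (μ := P) B1 B2
    linarith
  · simp only [Set.mem_union, not_or] at hω
    have h1 := b1 ω hω.1.1 x
    have h2 := b2 ω hω.1.2 (-x)
    have h3 : ν.real {p : ℝ × ℝ | p.2 < p.1} - ε
        < empFreq (fun i ω => (L i ω, U i ω)) {p : ℝ × ℝ | p.2 < p.1} ω := not_le.1 hω.2
    rw [sigma_eq hx, empCover_eq X hn ω hx]
    simp only [Pi.neg_apply] at h2
    linarith

/-- The constant in the polynomial bound for the probability of poor coverage. -/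
def coverConst (σ₀ : ℝ) : ℝ := (2 * ⌈1 / (σ₀ / 10)⌉₊ + 3) * (6 / (2 * (σ₀ / 10) ^ 2) ^ 3)

lemma exists_event_half_cover [IsProbabilityMeasure P]
    (h : IsCensoredSample P f ν X L U) (hn : 0 < n) {σ₀ : ℝ}
    (hσ₀ : 0 < σ₀) (hσ : ∀ x ∈ circle, σ₀ ≤ sigma ν x) :
    ∃ B : Set Ω, MeasurableSet B ∧ P.real B ≤ coverConst σ₀ / (n : ℝ) ^ 3 ∧
      ∀ ω ∉ B, ∀ x ∈ circle, σ₀ / 2 ≤ empCover (sampleObs X L U ω) x := by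
  have hn' : (0 : ℝ) < n := by exact_mod_cast hn
  -- The loss `5 ε` is `2 ε` for each endpoint and `ε` for the frequency of `u < l`; with `ε = σ₀ /
  -- 10` it equals `σ₀ / 2`.
  obtain ⟨B, hB, hp, hb⟩ := exists_event_empCover h hn (show 0 < σ₀ / 10 by positivity)
  refine ⟨B, hB, hp.trans ?_, fun ω hω x hx => ?_⟩
  · rw [coverConst, mul_div_assoc]
    refine mul_le_mul_of_nonneg_left ?_ (by positivity)
    set y := 2 * (n : ℝ) * (σ₀ / 10) ^ 2 with hy
    have hy0 : 0 < y := by positivity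
    -- From `y³ / 3! ≤ exp y`. The cube is what turns the crude `n²` error bound into `1 / n`.
    have h1 := Real.pow_div_factorial_le_exp y hy0.le 3
    have h2 : 6 / (2 * (σ₀ / 10) ^ 2) ^ 3 / (n : ℝ) ^ 3 = (y ^ 3 / (Nat.factorial 3 : ℕ))⁻¹ := by
      have : ((Nat.factorial 3 : ℕ) : ℝ) = 6 := by norm_num [Nat.factorial]
      rw [this, hy]
      field_simp
    rw [h2, Real.exp_neg]
    exact inv_anti₀ (by positivity) h1
  · have h1 := hb ω hω x hx
    have h2 := hσ x hx
    linarith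

end Coverage

/-! ### The stochastic term: centring and variance. -/

/-- The centred contribution of one individual to the empirical coefficient of `φ`, where `α` is
the law of the variable of interest. -/
def score (α : Measure ℝ) (φ : ℝ → ℝ) (z : ℝ × (ℝ × ℝ)) : ℝ :=
  (arc z.2.1 z.2.2).indicator φ z.1 - ∫ y, (arc z.2.1 z.2.2).indicator φ y ∂α

section Score

variable {α : Measure ℝ} {ν : Measure (ℝ × ℝ)} [IsProbabilityMeasure α] [IsProbabilityMeasure ν]
  {φ : ℝ → ℝ} {C : ℝ}

lemma measurable_indicator_arc (hφ : Measurable φ) :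
    Measurable fun q : (ℝ × ℝ) × ℝ => (arc q.1.1 q.1.2).indicator φ q.2 :=
  (hφ.comp measurable_snd).indicator measurableSet_arc_prod

lemma measurable_integral_indicator_arc {α : Measure ℝ} [SFinite α] (hφ : Measurable φ) :
    Measurable fun p : ℝ × ℝ => ∫ y, (arc p.1 p.2).indicator φ y ∂α :=
  (StronglyMeasurable.integral_prod_right (f := fun (p : ℝ × ℝ) y => (arc p.1 p.2).indicator φ y)
    (measurable_indicator_arc hφ).stronglyMeasurable).measurable

lemma measurable_score (hφ : Measurable φ) : Measurable (score α φ) :=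
  ((measurable_indicator_arc hφ).comp (measurable_snd.prodMk measurable_fst)).sub
    ((measurable_integral_indicator_arc hφ).comp measurable_snd)

lemma abs_indicator_le (hC : ∀ x, |φ x| ≤ C) (A : Set ℝ) (x : ℝ) : |A.indicator φ x| ≤ C := by
  by_cases hx : x ∈ A
  · simpa [hx] using hC x
  · simpa [hx] using (abs_nonneg _).trans (hC x)

lemma abs_score_le (hC : ∀ x, |φ x| ≤ C) (z : ℝ × (ℝ × ℝ)) : |score α φ z| ≤ 2 * C := by
  have h1 := abs_indicator_le hC (arc z.2.1 z.2.2)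
  have h2 : ‖∫ y, (arc z.2.1 z.2.2).indicator φ y ∂α‖ ≤ C * α.real Set.univ :=
    norm_integral_le_of_norm_le_const (Filter.Eventually.of_forall h1)
  rw [probReal_univ, mul_one, Real.norm_eq_abs] at h2
  have h3 := abs_sub ((arc z.2.1 z.2.2).indicator φ z.1)
    (∫ y, (arc z.2.1 z.2.2).indicator φ y ∂α)
  have := h1 z.1
  rw [score]
  linarith

lemma integrable_of_abs_le {S : Type*} [MeasurableSpace S] {μ : Measure S} [IsFiniteMeasure μ]
    {g : S → ℝ} (hg : Measurable g) {K : ℝ} (hK : ∀ x, |g x| ≤ K) : Integrable g μ :=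
  Integrable.of_bound hg.aestronglyMeasurable K (Filter.Eventually.of_forall hK)

lemma integral_score (hφ : Measurable φ) (hC : ∀ x, |φ x| ≤ C) :
    ∫ z, score α φ z ∂(α.prod ν) = 0 := by
  rw [integral_prod_symm _ (integrable_of_abs_le (measurable_score hφ) (abs_score_le hC))]
  have : ∀ p, ∫ x, score α φ (x, p) ∂α = 0 := by
    intro p
    simp only [score]
    rw [integral_sub (integrable_of_abs_le (hφ.indicator (measurableSet_arc _ _))
      (abs_indicator_le hC _)) (integrable_const _)]
    simp
  simp [this]

/-- For a fixed window the score is a centred variable, so its second moment is a variance, at most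
the second moment of the indicator times `φ`. Fubini then averages over windows. -/
lemma integral_score_sq_le (hφ : Measurable φ) (hC : ∀ x, |φ x| ≤ C) :
    ∫ z, score α φ z ^ 2 ∂(α.prod ν) ≤ ∫ x, φ x ^ 2 ∂α := by
  have hsq : ∀ {S : Type} {g : S → ℝ} {K : ℝ}, (∀ x, |g x| ≤ K) → ∀ x, |g x ^ 2| ≤ K ^ 2 := by
    intro S g K h x
    rw [abs_pow]; exact pow_le_pow_left₀ (abs_nonneg _) (h x) 2
  have hi := integrable_of_abs_le (μ := α.prod ν) ((measurable_score (α := α) hφ).pow_const 2)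
    (hsq (abs_score_le hC))
  rw [integral_prod_symm _ hi]
  have hφ2 : Integrable (fun x => φ x ^ 2) α := integrable_of_abs_le (hφ.pow_const 2) (hsq hC)
  have : ∀ p, ∫ x, score α φ (x, p) ^ 2 ∂α ≤ ∫ x, φ x ^ 2 ∂α := by
    intro p
    have hm : Measurable ((arc p.1 p.2).indicator φ) := hφ.indicator (measurableSet_arc _ _)
    have h1 : ∫ x, score α φ (x, p) ^ 2 ∂α = Var[(arc p.1 p.2).indicator φ; α] := by
      rw [variance_eq_integral hm.aemeasurable]; rfl
    rw [h1]
    refine (variance_le_expectation_sq hm.aestronglyMeasurable).trans (integral_mono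
      (integrable_of_abs_le (hm.pow_const 2) (hsq (abs_indicator_le hC _))) hφ2 fun x => ?_)
    by_cases hx : x ∈ arc p.1 p.2
    · simp [hx]
    · simp [hx, sq_nonneg]
  refine (integral_mono hi.integral_prod_right (integrable_const _) this).trans ?_
  simp

end Score

section Noise

variable {Ω : Type*} [MeasurableSpace Ω] {P : Measure Ω} [IsProbabilityMeasure P]

lemma integral_sq_mean_le {n : ℕ} (hn : 0 < n) {Y : Fin n → Ω → ℝ} (hY : ∀ i, MemLp (Y i) 2 P)
    (hind : iIndepFun Y P) (h0 : ∀ i, ∫ ω, Y i ω ∂P = 0) {v : ℝ}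
    (hv : ∀ i, ∫ ω, Y i ω ^ 2 ∂P ≤ v) :
    ∫ ω, ((1 / (n : ℝ)) * ∑ i, Y i ω) ^ 2 ∂P ≤ v / n := by
  have hn' : (0 : ℝ) < n := by exact_mod_cast hn
  have h1 := IndepFun.variance_sum (s := Finset.univ) (fun i _ => hY i)
    (fun i _ j _ hij => hind.indepFun hij)
  have hmem : MemLp (∑ i, Y i) 2 P := memLp_finsetSum' _ fun i _ => hY i
  have hmean : ∫ ω, (∑ i, Y i) ω ∂P = 0 := by
    simp only [Finset.sum_apply]
    rw [integral_finsetSum _ fun i _ => (hY i).integrable (by norm_num)]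
    simp [h0]
  rw [variance_of_integral_eq_zero hmem.aestronglyMeasurable.aemeasurable hmean] at h1
  have h2 : ∀ i, Var[Y i; P] ≤ v := fun i => by
    rw [variance_of_integral_eq_zero (hY i).aestronglyMeasurable.aemeasurable (h0 i)]
    exact hv i
  have h3 : ∫ ω, (∑ i, Y i) ω ^ 2 ∂P ≤ n * v := by
    rw [h1]
    exact (Finset.sum_le_sum fun i _ => h2 i).trans_eq (by simp)
  simp only [mul_pow, Finset.sum_apply] at h3 ⊢
  rw [integral_const_mul]
  calc (1 / (n : ℝ)) ^ 2 * ∫ ω, (∑ i, Y i ω) ^ 2 ∂P ≤ (1 / (n : ℝ)) ^ 2 * (n * v) := by gcongr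
    _ = v / n := by field_simp

variable {f : ℝ → ℝ} {ν : Measure (ℝ × ℝ)} {n : ℕ} {X L U : Fin n → Ω → ℝ}

/-- The centred empirical coefficients. -/
def noise {n : ℕ} (o : Fin n → Obs) (m : ℕ) (f : ℝ → ℝ) (j : Fin (dimS m)) : ℝ :=
  empCoeff o m j - ∫ x, empCover o x * (f x * trig j x) ∂circleVol

/-- A censored value `-π` is multiplied by `Δ = 0`, so the placeholder never matters. -/
lemma ind_mul_value (x l u : ℝ) (t : ℝ → ℝ) :
    (observe x l u).ind * t (observe x l u).value = (arc l u).indicator t x := by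
  by_cases h : x ∈ arc l u <;> simp [observe, h]

lemma integral_density (hf : AEMeasurable f circleVol) (hf0 : ∀ᵐ x ∂circleVol, 0 ≤ f x)
    (g : ℝ → ℝ) :
    ∫ x, g x ∂(circleVol.withDensity fun x => ENNReal.ofReal (f x))
      = ∫ x, f x * g x ∂circleVol := by
  rw [integral_withDensity_eq_integral_toReal_smul₀ hf.ennreal_ofReal
    (Filter.Eventually.of_forall fun _ => ENNReal.ofReal_lt_top)]
  refine integral_congr_ae ?_
  filter_upwards [hf0] with x hx
  rw [ENNReal.toReal_ofReal hx, smul_eq_mul]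

lemma noise_eq {Ω : Type*} {n : ℕ} {X L U : Fin n → Ω → ℝ} (hf : AEMeasurable f circleVol)
    (hfi : Integrable f circleVol) (hf0 : ∀ᵐ x ∂circleVol, 0 ≤ f x) {m : ℕ}
    (j : Fin (dimS m)) (ω : Ω) :
    noise (sampleObs X L U ω) m f j = (1 / (n : ℝ)) * ∑ i,
      score (circleVol.withDensity fun x => ENNReal.ofReal (f x)) (trig j)
        (X i ω, L i ω, U i ω) := by
  have hi : Integrable (fun x => f x * trig j x) circleVol :=
    hfi.mul_bdd (c := 1) (continuous_trig j).aestronglyMeasurable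
      (Filter.Eventually.of_forall (abs_trig_le_one j))
  rw [noise, integral_empCover_mul _ hi, empCoeff]
  simp only [score, sampleObs, ind_mul_value, integral_density hf hf0]
  rw [← mul_sub, ← Finset.sum_sub_distrib]
  congr 1
  refine Finset.sum_congr rfl fun i _ => ?_
  congr 2
  ext x
  by_cases hx : x ∈ arc (L i ω) (U i ω)
  · simp [observe, hx]
  · simp [observe, hx]

lemma IsCensoredSample.isProbabilityMeasure_density (h : IsCensoredSample P f ν X L U)
    (hn : 0 < n) :
    IsProbabilityMeasure (circleVol.withDensity fun x => ENNReal.ofReal (f x)) := by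
  rw [← h.law_X ⟨0, hn⟩]
  exact Measure.isProbabilityMeasure_map (h.measurable_X _).aemeasurable

lemma IsCensoredSample.law_triplet (h : IsCensoredSample P f ν X L U) (i : Fin n) :
    P.map (fun ω => (X i ω, L i ω, U i ω))
      = (circleVol.withDensity fun x => ENNReal.ofReal (f x)).prod ν := by
  have hind : IndepFun (X i) (fun ω => (L i ω, U i ω)) P :=
    h.indep_X_LU.comp (measurable_pi_apply i) (measurable_pi_apply i)
  have := (indepFun_iff_map_prod_eq_prod_map_map (h.measurable_X i).aemeasurable
    (h.measurable_LU i).aemeasurable).1 hind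
  rw [h.law_X, h.law_LU] at this
  exact this

lemma measurable_noise (h : IsCensoredSample P f ν X L U) (hn : 0 < n)
    (hf : AEMeasurable f circleVol) (hfi : Integrable f circleVol)
    (hf0 : ∀ᵐ x ∂circleVol, 0 ≤ f x) {m : ℕ} (j : Fin (dimS m)) :
    Measurable fun ω => noise (sampleObs X L U ω) m f j := by
  have := h.isProbabilityMeasure_density hn
  simp_rw [noise_eq hf hfi hf0]
  exact (Finset.measurable_sum _ fun i _ => (measurable_score (continuous_trig j).measurable).comp
    ((h.measurable_X i).prodMk (h.measurable_LU i))).const_mul _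

lemma abs_noise_le (h : IsCensoredSample P f ν X L U) (hn : 0 < n)
    (hf : AEMeasurable f circleVol) (hfi : Integrable f circleVol)
    (hf0 : ∀ᵐ x ∂circleVol, 0 ≤ f x) {m : ℕ} (j : Fin (dimS m)) (ω : Ω) :
    |noise (sampleObs X L U ω) m f j| ≤ 2 := by
  have := h.isProbabilityMeasure_density hn
  have hn' : (0 : ℝ) < n := by exact_mod_cast hn
  rw [noise_eq hf hfi hf0, abs_mul, abs_of_pos (by positivity), one_div, inv_mul_le_iff₀ hn']
  refine (Finset.abs_sum_le_sum_abs _ _).trans ((Finset.sum_le_sum fun i _ =>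
    abs_score_le (abs_trig_le_one j) _).trans_eq ?_)
  simp

lemma integrable_sum_noise_sq (h : IsCensoredSample P f ν X L U) (hn : 0 < n)
    (hf : AEMeasurable f circleVol) (hfi : Integrable f circleVol)
    (hf0 : ∀ᵐ x ∂circleVol, 0 ≤ f x) (m : ℕ) (j : Fin (dimS m)) :
    Integrable (fun ω => noise (sampleObs X L U ω) m f j ^ 2) P := by
  refine integrable_of_abs_le (K := 2 ^ 2) ((measurable_noise h hn hf hfi hf0 j).pow_const 2)
    fun ω => ?_
  rw [abs_pow]
  exact pow_le_pow_left₀ (abs_nonneg _) (abs_noise_le h hn hf hfi hf0 j ω) 2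

/-- The variance bound for the centred empirical coefficients. -/
lemma integral_sum_noise_sq_le (h : IsCensoredSample P f ν X L U) (hn : 0 < n)
    (hf : AEMeasurable f circleVol) (hfi : Integrable f circleVol)
    (hf0 : ∀ᵐ x ∂circleVol, 0 ≤ f x) (m : ℕ) :
    ∫ ω, ∑ j, noise (sampleObs X L U ω) m f j ^ 2 ∂P ≤ (dimS m : ℝ) / n := by
  have hα := h.isProbabilityMeasure_density hn
  have hν := h.isProbabilityMeasure hn
  set α := circleVol.withDensity fun x => ENNReal.ofReal (f x) with hαdef
  rw [integral_finsetSum _ fun j _ => integrable_sum_noise_sq h hn hf hfi hf0 m j]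
  have hj : ∀ j : Fin (dimS m), ∫ ω, noise (sampleObs X L U ω) m f j ^ 2 ∂P
      ≤ (∫ x, trig j x ^ 2 ∂α) / n := by
    intro j
    have hmeas : Measurable (score α (trig j)) := measurable_score (continuous_trig j).measurable
    have htr : ∀ i, Measurable fun ω => (X i ω, L i ω, U i ω) := fun i =>
      (h.measurable_X i).prodMk (h.measurable_LU i)
    simp_rw [noise_eq hf hfi hf0]
    refine integral_sq_mean_le hn (Y := fun i ω => score α (trig j) (X i ω, L i ω, U i ω))
      (fun i => ?_) (h.indep_triplets.comp (fun _ => score α (trig j)) fun _ => hmeas)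
      (fun i => ?_) (fun i => ?_)
    · exact MemLp.of_bound (hmeas.comp (htr i)).aestronglyMeasurable _
        (Filter.Eventually.of_forall fun ω => abs_score_le (abs_trig_le_one j) _)
    · rw [← integral_map (htr i).aemeasurable hmeas.aestronglyMeasurable, h.law_triplet i]
      exact integral_score (continuous_trig j).measurable (abs_trig_le_one j)
    · rw [← integral_map (f := fun z => score α (trig j) z ^ 2) (htr i).aemeasurable
        (hmeas.pow_const 2).aestronglyMeasurable, h.law_triplet i]
      exact integral_score_sq_le (continuous_trig j).measurable (abs_trig_le_one j)
  refine (Finset.sum_le_sum fun j _ => hj j).trans ?_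
  rw [← Finset.sum_div]
  gcongr
  have hi : ∀ j : Fin (dimS m), Integrable (fun x => trig j x ^ 2) α := fun j =>
    integrable_of_abs_le (K := 1) ((continuous_trig j).measurable.pow_const 2) fun x => by
      rw [abs_pow]; exact pow_le_one₀ (abs_nonneg _) (abs_trig_le_one j x)
  refine (Finset.sum_le_sum fun j _ => (integral_mono (hi j) (integrable_const (1 : ℝ))
    fun x => ?_)).trans_eq ?_
  · have := pow_le_one₀ (n := 2) (abs_nonneg _) (abs_trig_le_one j x)
    simpa using this
  · simp

end Noise

/-! ### Measurability of the least-squares coefficients -/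

lemma measurable_det {S ι : Type*} [MeasurableSpace S] [Fintype ι] [DecidableEq ι]
    {A : S → Matrix ι ι ℝ} (hA : ∀ i j, Measurable fun s => A s i j) :
    Measurable fun s => (A s).det := by
  simp only [Matrix.det_apply]
  exact Finset.measurable_sum _ fun σ _ =>
    (Finset.measurable_prod _ fun i _ => hA (σ i) i).const_smul (Equiv.Perm.sign σ)

/-- Cramer's formula, adjugate over determinant; it also covers singular matrices, whose inverse is
zero by convention. -/
lemma measurable_inv_apply {S ι : Type*} [MeasurableSpace S] [Fintype ι] [DecidableEq ι]
    {A : S → Matrix ι ι ℝ} (hA : ∀ i j, Measurable fun s => A s i j) (i j : ι) :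
    Measurable fun s => (A s)⁻¹ i j := by
  simp only [Matrix.inv_def, Matrix.smul_apply, smul_eq_mul, Ring.inverse_eq_inv',
    Matrix.adjugate_apply]
  refine (measurable_det hA).inv.mul (measurable_det fun k l => ?_)
  simp only [Matrix.updateRow_apply]
  split_ifs
  · exact measurable_const
  · exact hA k l

section Measurability

variable {Ω : Type*} [MeasurableSpace Ω] {P : Measure Ω}
  {f : ℝ → ℝ} {ν : Measure (ℝ × ℝ)} {n : ℕ} {X L U : Fin n → Ω → ℝ}

lemma measurable_gram (h : IsCensoredSample P f ν X L U) (m : ℕ) (j k : Fin (dimS m)) :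
    Measurable fun ω => gram (sampleObs X L U ω) m j k := by
  have hc : Continuous fun x => trig j x * trig k x :=
    (continuous_trig _).mul (continuous_trig _)
  simp only [gram, Matrix.of_apply, integral_empCover_mul _ (integrable_of_continuous hc)]
  exact (Finset.measurable_sum _ fun i _ =>
    (measurable_integral_indicator_arc hc.measurable).comp (h.measurable_LU i)).const_mul _

lemma measurable_empCoeff (h : IsCensoredSample P f ν X L U) (m : ℕ) (j : Fin (dimS m)) :
    Measurable fun ω => empCoeff (sampleObs X L U ω) m j := by
  simp only [empCoeff, sampleObs, ind_mul_value]
  exact (Finset.measurable_sum _ fun i _ =>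
    (measurable_indicator_arc (continuous_trig j).measurable).comp
      ((h.measurable_LU i).prodMk (h.measurable_X i))).const_mul _

lemma measurable_lsCoeff (h : IsCensoredSample P f ν X L U) (m : ℕ) (j : Fin (dimS m)) :
    Measurable fun ω => lsCoeff (sampleObs X L U ω) m j := by
  simp only [lsCoeff, Matrix.mulVec, dotProduct]
  exact Finset.measurable_sum _ fun k _ =>
    (measurable_inv_apply (measurable_gram h m) j k).mul (measurable_empCoeff h m k)

end Measurability

/-! ### Deterministic error analysis -/

section Deterministic

variable {n m : ℕ} {o : Fin n → Obs} {f : ℝ → ℝ} {s : ℝ}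

/-- The quadratic form is the integral of the squared polynomial against the coverage, so a
pointwise lower bound on the coverage bounds the eigenvalues of `gram`. -/
lemma dotProduct_gram_ge (hcov : ∀ x ∈ circle, s / 2 ≤ empCover o x) (d : Fin (dimS m) → ℝ) :
    s / 2 * ∑ j, d j ^ 2 ≤ d ⬝ᵥ (gram o m).mulVec d := by
  have hc : Continuous fun x => trigPoly d x * trigPoly d x :=
    (continuous_trigPoly d).mul (continuous_trigPoly d)
  rw [dotProduct_gram, ← normSq2_trigPoly, normSq2, ← integral_const_mul]
  refine integral_mono_ae ((memLp_trigPoly d 2).integrable_sq.const_mul _)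
    (Integrable.empCover_mul o (integrable_of_continuous hc)) ?_
  filter_upwards [ae_circleVol_mem] with x hx
  rw [← sq]
  exact mul_le_mul_of_nonneg_right (hcov x hx) (sq_nonneg _)

/-- Young's inequality with a free weight `A`, chosen later so that the quadratic term is absorbed
by the coercivity of `gram`. -/
lemma sum_mul_le {ι : Type*} [Fintype ι] (u v : ι → ℝ) {A : ℝ} (hA : 0 < A) :
    ∑ j, u j * v j ≤ A * ∑ j, u j ^ 2 + 1 / (4 * A) * ∑ j, v j ^ 2 := by
  rw [Finset.mul_sum, Finset.mul_sum, ← Finset.sum_add_distrib]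
  refine Finset.sum_le_sum fun j _ => ?_
  have h : A * u j ^ 2 + 1 / (4 * A) * v j ^ 2 - u j * v j = (2 * A * u j - v j) ^ 2 / (4 * A) := by
    field_simp
    ring
  have : 0 ≤ (2 * A * u j - v j) ^ 2 / (4 * A) := by positivity
  linarith

lemma sum_mul_noise (hf : MemLp f 2 circleVol) (d : Fin (dimS m) → ℝ) :
    ∑ j, d j * noise o m f j
      = d ⬝ᵥ empCoeff o m - ∫ x, empCover o x * (f x * trigPoly d x) ∂circleVol := by
  have h : ∀ x, empCover o x * (f x * trigPoly d x)
      = ∑ j, d j * (empCover o x * (f x * trig j x)) := by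
    intro x
    simp only [trigPoly, Finset.mul_sum]
    exact Finset.sum_congr rfl fun j _ => by ring
  simp_rw [h]
  rw [integral_finsetSum]
  swap
  · exact fun j _ => (Integrable.empCover_mul o
      (integrable_mul_of_memLp hf (memLp_trig j 2))).const_mul _
  simp only [noise, mul_sub, Finset.sum_sub_distrib, integral_const_mul, dotProduct]

/-- When the empirical coverage is bounded below, the least-squares coefficients are close to the
Fourier coefficients of `f`. -/
lemma sum_lsCoeff_sub_sq_le (hf : MemLp f 2 circleVol) (hs : 0 < s)
    (hcov : ∀ x ∈ circle, s / 2 ≤ empCover o x)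
    (hG : (gram o m).mulVec (lsCoeff o m) = empCoeff o m) :
    ∑ j, (lsCoeff o m j - trigCoeff m f j) ^ 2
      ≤ 8 / s ^ 2 * (∑ j, noise o m f j ^ 2
        + normSq2 (fun x => trigPoly (trigCoeff m f) x - f x)) := by
  set d := lsCoeff o m - trigCoeff m f with hd
  set t := trigPoly d with ht
  set r : ℝ → ℝ := fun x => trigPoly (trigCoeff m f) x - f x with hr
  have hr2 : MemLp r 2 circleVol := (memLp_trigPoly _ 2).sub hf
  have ht2 : MemLp t 2 circleVol := memLp_trigPoly d 2
  have h1 := dotProduct_gram_ge hcov d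
  -- The normal equations give `G d = b - G c`, with `c` the Fourier coefficients; replacing the
  -- projection by `f + r` splits this into noise and bias.
  have h2 : d ⬝ᵥ (gram o m).mulVec d
      = ∑ j, d j * noise o m f j - ∫ x, empCover o x * (r x * t x) ∂circleVol := by
    rw [sum_mul_noise hf, hd, Matrix.mulVec_sub, hG, dotProduct_sub, dotProduct_gram, ← hd, ← ht,
      sub_sub, ← integral_add
        (Integrable.empCover_mul o (integrable_mul_of_memLp hf ht2))
        (Integrable.empCover_mul o (integrable_mul_of_memLp hr2 ht2))]
    congr 2
    ext x
    simp only [hr]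
    ring
  -- Weight `s / 8` here and again for the bias: together they use half of the available `s / 2`.
  have h3 := sum_mul_le d (noise o m f) (show 0 < s / 8 by positivity)
  have h4 : -∫ x, empCover o x * (r x * t x) ∂circleVol
      ≤ s / 8 * ∑ j, d j ^ 2 + 2 / s * normSq2 r := by
    rw [← normSq2_trigPoly, normSq2, normSq2, ← integral_const_mul, ← integral_const_mul,
      ← integral_neg, ← integral_add (ht2.integrable_sq.const_mul _)
        (hr2.integrable_sq.const_mul _)]
    refine integral_mono (Integrable.empCover_mul o (integrable_mul_of_memLp hr2 ht2)).neg
      ((ht2.integrable_sq.const_mul _).add (hr2.integrable_sq.const_mul _)) fun x => ?_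
    have e1 : -(empCover o x * (r x * t x)) ≤ |r x * t x| := by
      refine (neg_le_abs _).trans ?_
      rw [abs_mul]
      exact mul_le_of_le_one_left (abs_nonneg _) (abs_empCover_le_one o x)
    have e2 : |r x * t x| ≤ s / 8 * t x ^ 2 + 2 / s * r x ^ 2 := by
      rw [abs_mul]
      have : s / 8 * t x ^ 2 + 2 / s * r x ^ 2 - |r x| * |t x|
          = (s * |t x| - 4 * |r x|) ^ 2 / (8 * s) := by
        rw [← sq_abs (t x), ← sq_abs (r x)]
        field_simp
        ring
      have h0 : 0 ≤ (s * |t x| - 4 * |r x|) ^ 2 / (8 * s) := by positivity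
      linarith
    exact e1.trans e2
  have h5 : 1 / (4 * (s / 8)) = 2 / s := by field_simp; norm_num
  rw [h5] at h3
  have h6 : s / 4 * ∑ j, d j ^ 2 ≤ 2 / s * (∑ j, noise o m f j ^ 2 + normSq2 r) := by
    rw [mul_add]
    linarith
  have h7 : ∑ j, d j ^ 2 = 4 / s * (s / 4 * ∑ j, d j ^ 2) := by field_simp
  have h8 : 8 / s ^ 2 * (∑ j, noise o m f j ^ 2 + normSq2 r)
      = 4 / s * (2 / s * (∑ j, noise o m f j ^ 2 + normSq2 r)) := by field_simp; ring
  have h9 : ∑ j, (lsCoeff o m j - trigCoeff m f j) ^ 2 = ∑ j, d j ^ 2 := rfl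
  rw [h9, h7, h8]
  gcongr

lemma sum_lsCoeff_sq_le (hs : 0 < s) (hcov : ∀ x ∈ circle, s / 2 ≤ empCover o x)
    (hG : (gram o m).mulVec (lsCoeff o m) = empCoeff o m) :
    ∑ j, lsCoeff o m j ^ 2 ≤ 4 / s ^ 2 * ∑ j, empCoeff o m j ^ 2 := by
  have h1 := dotProduct_gram_ge hcov (lsCoeff o m)
  rw [hG] at h1
  have h2 := sum_mul_le (lsCoeff o m) (empCoeff o m) (show 0 < s / 4 by positivity)
  have h3 : lsCoeff o m ⬝ᵥ empCoeff o m = ∑ j, lsCoeff o m j * empCoeff o m j := rfl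
  have h5 : 1 / (4 * (s / 4)) = 1 / s := by field_simp
  rw [h5] at h2
  have h6 : s / 4 * ∑ j, lsCoeff o m j ^ 2 ≤ 1 / s * ∑ j, empCoeff o m j ^ 2 := by linarith
  have h7 : ∑ j, lsCoeff o m j ^ 2 = 4 / s * (s / 4 * ∑ j, lsCoeff o m j ^ 2) := by field_simp
  have h8 : 4 / s ^ 2 * ∑ j, empCoeff o m j ^ 2
      = 4 / s * (1 / s * ∑ j, empCoeff o m j ^ 2) := by field_simp
  rw [h7, h8]
  gcongr

lemma sum_trigCoeff_sq (hf : MemLp f 2 circleVol) :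
    normSq2 (fun x => trigPoly (trigCoeff m f) x - f x)
      = normSq2 f - ∑ j, trigCoeff m f j ^ 2 := by
  rw [normSq2_trigPoly_sub hf]
  simp only [← sq]
  ring

/-- Pythagoras: the projection residual is orthogonal to `S_m`. -/
lemma sum_sub_sq (hf : MemLp f 2 circleVol) (c : Fin (dimS m) → ℝ) :
    ∑ j, c j ^ 2 - 2 * ∑ j, c j * trigCoeff m f j + normSq2 f
      = ∑ j, (c j - trigCoeff m f j) ^ 2
        + normSq2 (fun x => trigPoly (trigCoeff m f) x - f x) := by
  rw [sum_trigCoeff_sq hf]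
  simp only [sub_sq, Finset.sum_add_distrib, Finset.sum_sub_distrib, Finset.mul_sum]
  simp only [mul_assoc]
  ring

lemma normSq2_truncEstimator_sub_le (hf : MemLp f 2 circleVol)
    (hpos : ∀ d : Fin (dimS m) → ℝ, d ≠ 0 → 0 < d ⬝ᵥ (gram o m).mulVec d) :
    normSq2 (fun x => truncEstimator o m x - f x) ≤ 2 * (n : ℝ) ^ 2 + 2 * normSq2 f := by
  have hF := normSq2_nonneg f
  rw [normSq2_truncEstimator_sub hf hpos]
  split_ifs with h
  -- Nonnegativity of this square bounds the cross term, and Bessel's inequality (`h2`) bounds the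
  -- coefficients of `f`.
  · have h1 : 0 ≤ ∑ j, (lsCoeff o m j + trigCoeff m f j) ^ 2 :=
      Finset.sum_nonneg fun j _ => sq_nonneg _
    have h2 := normSq2_nonneg (fun x => trigPoly (trigCoeff m f) x - f x)
    rw [sum_trigCoeff_sq hf] at h2
    simp only [add_sq, Finset.sum_add_distrib, mul_assoc, ← Finset.mul_sum] at h1
    linarith
  · nlinarith [sq_nonneg (n : ℝ)]

end Deterministic

lemma abs_empCoeff_le {Ω : Type*} {n m : ℕ} {X L U : Fin n → Ω → ℝ} (hn : 0 < n)
    (j : Fin (dimS m)) (ω : Ω) : |empCoeff (sampleObs X L U ω) m j| ≤ 1 := by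
  have hn' : (0 : ℝ) < n := by exact_mod_cast hn
  simp only [empCoeff, sampleObs, ind_mul_value]
  rw [abs_mul, abs_of_pos (by positivity), one_div, inv_mul_le_iff₀ hn']
  refine (Finset.abs_sum_le_sum_abs _ _).trans ((Finset.sum_le_sum fun i _ =>
    abs_indicator_le (abs_trig_le_one j) _ _).trans_eq ?_)
  simp

lemma normSq2_le_supNorm {f : ℝ → ℝ} (hf : MemLp f ⊤ circleVol) :
    normSq2 f ≤ 2 * Real.pi * supNorm f ^ 2 := by
  have h : ∀ᵐ x ∂circleVol, f x ^ 2 ≤ supNorm f ^ 2 := by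
    have := ae_le_eLpNormEssSup (f := f) (μ := circleVol)
    rw [← eLpNorm_exponent_top] at this
    filter_upwards [this] with x hx
    have h1 := ENNReal.toReal_mono hf.2.ne hx
    rw [toReal_enorm, Real.norm_eq_abs] at h1
    rw [← sq_abs]
    exact pow_le_pow_left₀ (abs_nonneg _) h1 2
  have := integral_mono_ae (hf.mono_exponent le_top : MemLp f 2 circleVol).integrable_sq
    (integrable_const _) h
  rw [integral_const, circleVol_real_univ] at this
  exact this

lemma coverConst_nonneg {σ₀ : ℝ} (hσ₀ : 0 < σ₀) : 0 ≤ coverConst σ₀ := by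
  rw [coverConst]; positivity

/-- The constant in front of the remainder term of the risk bound. -/
def remainderConst (σ₀ M : ℝ) : ℝ :=
  (2 + 4 * Real.pi * M ^ 2) * (coverConst σ₀ + (4 / σ₀ ^ 2) ^ 3)

lemma remainderConst_nonneg {σ₀ : ℝ} (hσ₀ : 0 < σ₀) (M : ℝ) : 0 ≤ remainderConst σ₀ M := by
  have := coverConst_nonneg hσ₀
  rw [remainderConst]; positivity

/-! ### Almost sure uniqueness, integrability and the risk bound. -/

section Risk

variable {Ω : Type*} [MeasurableSpace Ω] {P : Measure Ω}
  {f : ℝ → ℝ} {ν : Measure (ℝ × ℝ)} {n m : ℕ} {X L U : Fin n → Ω → ℝ} {σ₀ : ℝ}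

lemma ae_gram_pos (h : IsCensoredSample P f ν X L U) (hn : 0 < n) (m : ℕ) :
    ∀ᵐ ω ∂P, ∀ d : Fin (dimS m) → ℝ, d ≠ 0 →
      0 < d ⬝ᵥ (gram (sampleObs X L U ω) m).mulVec d := by
  filter_upwards [h.ne_LU ⟨0, hn⟩] with ω hω d hd
  exact gram_pos _ ⟨0, hn⟩ (h.mem_L _ ω) (h.mem_U _ ω) hω hd

lemma ae_existsUnique (h : IsCensoredSample P f ν X L U) (hn : 0 < n) (m : ℕ) :
    ∀ᵐ ω ∂P, ∃! t, IsLeastSquares (sampleObs X L U ω) m t := by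
  filter_upwards [ae_gram_pos h hn m] with ω hω
  exact ⟨_, (isLeastSquares_iff hω _).2 rfl, fun t ht => (isLeastSquares_iff hω t).1 ht⟩

/-- The estimator is picked by choice, so measurability is read off the explicit formula with which
the error agrees almost surely. -/
lemma aestronglyMeasurable_ise (h : IsCensoredSample P f ν X L U) (hn : 0 < n)
    (hf : MemLp f 2 circleVol) : AEStronglyMeasurable (ise X L U m f) P := by
  classical
  have hm : Measurable fun ω =>
      if ∑ j, lsCoeff (sampleObs X L U ω) m j ^ 2 ≤ (n : ℝ) ^ 2 then
        ∑ j, lsCoeff (sampleObs X L U ω) m j ^ 2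
          - 2 * ∑ j, lsCoeff (sampleObs X L U ω) m j * trigCoeff m f j + normSq2 f
      else normSq2 f := by
    have h1 : Measurable fun ω => ∑ j, lsCoeff (sampleObs X L U ω) m j ^ 2 :=
      Finset.measurable_sum _ fun j _ => (measurable_lsCoeff h m j).pow_const 2
    have h2 : Measurable fun ω => ∑ j, lsCoeff (sampleObs X L U ω) m j * trigCoeff m f j :=
      Finset.measurable_sum _ fun j _ => (measurable_lsCoeff h m j).mul_const _
    exact Measurable.ite (measurableSet_le h1 measurable_const)
      ((h1.sub (h2.const_mul 2)).add_const _) measurable_const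
  refine hm.aestronglyMeasurable.congr ?_
  filter_upwards [ae_gram_pos h hn m] with ω hω
  rw [ise, normSq2_truncEstimator_sub hf hω]

lemma integrable_ise [IsProbabilityMeasure P]
    (h : IsCensoredSample P f ν X L U) (hn : 0 < n)
    (hf : MemLp f 2 circleVol) : Integrable (ise X L U m f) P := by
  refine Integrable.of_bound (aestronglyMeasurable_ise h hn hf)
    (2 * (n : ℝ) ^ 2 + 2 * normSq2 f) ?_
  filter_upwards [ae_gram_pos h hn m] with ω hω
  rw [ise, Real.norm_of_nonneg (normSq2_nonneg _)]
  exact normSq2_truncEstimator_sub_le hf hω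

/-- The risk bound, with explicit constants. -/
lemma integral_ise_le [IsProbabilityMeasure P]
    (h : IsCensoredSample P f ν X L U)
    (hσ₀ : 0 < σ₀) (hσ : ∀ x ∈ circle, σ₀ ≤ sigma ν x) (hf : MemLp f ⊤ circleVol)
    (hf0 : ∀ᵐ x ∂circleVol, 0 ≤ f x) (hm : m ∈ indexSet n) :
    ∫ ω, ise X L U m f ω ∂P
      ≤ (8 / σ₀ ^ 2 + 1) * normSq2 (fun x => trigPoly (trigCoeff m f) x - f x)
        + 8 / σ₀ ^ 2 * ((dimS m : ℝ) / n) + remainderConst σ₀ (supNorm f) * (1 / (n : ℝ)) := by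
  classical
  have hmn : dimS m ≤ n ∧ 0 < n := by
    rw [indexSet, Finset.mem_Icc] at hm
    rw [dimS]
    omega
  obtain ⟨hDn, hn⟩ := hmn
  have hDn' : (dimS m : ℝ) ≤ n := by exact_mod_cast hDn
  have hn' : (0 : ℝ) < n := by exact_mod_cast hn
  have hn1 : (1 : ℝ) ≤ n := by exact_mod_cast hn
  have hf2 : MemLp f 2 circleVol := hf.mono_exponent le_top
  have hfi : Integrable f circleVol := hf2.integrable (by norm_num)
  obtain ⟨B, hB, hPB, hcov⟩ := exists_event_half_cover h hn hσ₀ hσ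
  set ρ := normSq2 (fun x => trigPoly (trigCoeff m f) x - f x) with hρ
  set F := normSq2 f with hF
  have hF0 : 0 ≤ F := normSq2_nonneg f
  have hρ0 : 0 ≤ ρ := normSq2_nonneg _
  -- Handles small samples: `κ ≥ 1` when `n < 4 / σ₀²`, so `K κ` dominates the crude bound `K`,
  -- while `κ` is of order `n⁻³` like the bad event.
  set κ : ℝ := (4 / σ₀ ^ 2) ^ 3 / (n : ℝ) ^ 3 with hκ
  set K : ℝ := 2 * (n : ℝ) ^ 2 + 2 * F with hK
  have hK0 : 0 ≤ K := by positivity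
  have hκ0 : 0 ≤ κ := by positivity
  have hN : ∀ ω, 0 ≤ ∑ j, noise (sampleObs X L U ω) m f j ^ 2 := fun ω =>
    Finset.sum_nonneg fun j _ => sq_nonneg _
  have hpt : ∀ᵐ ω ∂P, ise X L U m f ω ≤ ((8 / σ₀ ^ 2 + 1) * ρ
      + 8 / σ₀ ^ 2 * ∑ j, noise (sampleObs X L U ω) m f j ^ 2)
      + (K * B.indicator (fun _ => 1) ω + K * κ) := by
    filter_upwards [ae_gram_pos h hn m] with ω hω
    have hmain : 0 ≤ (8 / σ₀ ^ 2 + 1) * ρ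
        + 8 / σ₀ ^ 2 * ∑ j, noise (sampleObs X L U ω) m f j ^ 2 := by
      have := hN ω
      positivity
    have hcrude : ise X L U m f ω ≤ K := normSq2_truncEstimator_sub_le hf2 hω
    have hind : 0 ≤ B.indicator (fun _ => (1 : ℝ)) ω := Set.indicator_nonneg (by simp) _
    by_cases hωB : ω ∈ B
    · rw [Set.indicator_of_mem hωB]
      have := mul_nonneg hK0 hκ0
      linarith
    by_cases hsmall : (n : ℝ) < 4 / σ₀ ^ 2
    · have : 1 ≤ κ := by
        rw [hκ, one_le_div (by positivity)]
        exact pow_le_pow_left₀ hn'.le hsmall.le 3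
      have h1 : K ≤ K * κ := le_mul_of_one_le_right hK0 this
      have h2 := mul_nonneg hK0 hind
      linarith
    -- Here the truncation is inactive: the squared norm is at most `4 / σ₀²` times `D_m`, and both
    -- factors are at most `n`.
    · have hG := gram_mulVec_lsCoeff hω
      have h1 := sum_lsCoeff_sq_le hσ₀ (hcov ω hωB) hG
      have h2 : ∑ j, empCoeff (sampleObs X L U ω) m j ^ 2 ≤ n := by
        refine (Finset.sum_le_sum fun j _ => ?_).trans (b := ∑ _j : Fin (dimS m), (1 : ℝ)) ?_
        · rw [← sq_abs]
          exact pow_le_one₀ (abs_nonneg _) (abs_empCoeff_le hn j ω)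
        · simpa using hDn'
      have h3 : ∑ j, lsCoeff (sampleObs X L U ω) m j ^ 2 ≤ (n : ℝ) ^ 2 := by
        refine h1.trans ?_
        rw [sq (n : ℝ)]
        exact mul_le_mul (not_lt.1 hsmall) h2 (Finset.sum_nonneg fun j _ => sq_nonneg _) hn'.le
      have h4 := sum_lsCoeff_sub_sq_le hf2 hσ₀ (hcov ω hωB) hG
      rw [ise, normSq2_truncEstimator_sub hf2 hω, if_pos h3, sum_sub_sq hf2]
      have h5 := mul_nonneg hK0 hκ0
      have h6 := mul_nonneg hK0 hind
      rw [mul_add] at h4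
      linarith
  have hintN : Integrable (fun ω => ∑ j, noise (sampleObs X L U ω) m f j ^ 2) P :=
    integrable_finsetSum _ fun j _ =>
      integrable_sum_noise_sq h hn hf.1.aemeasurable hfi hf0 m j
  have hintB : Integrable (B.indicator fun _ => (1 : ℝ)) P := (integrable_const _).indicator hB
  have i1 : Integrable (fun ω => (8 / σ₀ ^ 2 + 1) * ρ
      + 8 / σ₀ ^ 2 * ∑ j, noise (sampleObs X L U ω) m f j ^ 2) P :=
    (integrable_const _).add (hintN.const_mul _)
  have i2 : Integrable (fun ω => K * B.indicator (fun _ => (1 : ℝ)) ω + K * κ) P :=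
    (hintB.const_mul _).add (integrable_const _)
  have h1 := integral_mono_ae (integrable_ise h hn hf2) (i1.add i2) hpt
  have hBint : ∫ ω, B.indicator (fun _ => (1 : ℝ)) ω ∂P = P.real B := integral_indicator_one hB
  have h2 : ∫ ω, ((8 / σ₀ ^ 2 + 1) * ρ + 8 / σ₀ ^ 2 * ∑ j, noise (sampleObs X L U ω) m f j ^ 2)
      + (K * B.indicator (fun _ => 1) ω + K * κ) ∂P
      = (8 / σ₀ ^ 2 + 1) * ρ
        + 8 / σ₀ ^ 2 * ∫ ω, ∑ j, noise (sampleObs X L U ω) m f j ^ 2 ∂P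
        + (K * P.real B + K * κ) := by
    rw [integral_add i1 i2, integral_add (integrable_const _) (hintN.const_mul _),
      integral_add (hintB.const_mul _) (integrable_const _), integral_const_mul
      (8 / σ₀ ^ 2), integral_const_mul K, hBint]
    simp
  have h3 := integral_sum_noise_sq_le h hn hf.1.aemeasurable hfi hf0 m
  have h4 : 8 / σ₀ ^ 2 * ∫ ω, ∑ j, noise (sampleObs X L U ω) m f j ^ 2 ∂P
      ≤ 8 / σ₀ ^ 2 * ((dimS m : ℝ) / n) := mul_le_mul_of_nonneg_left h3 (by positivity)
  have h5 : K * P.real B + K * κ ≤ remainderConst σ₀ (supNorm f) * (1 / (n : ℝ)) := by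
    have hcc := coverConst_nonneg hσ₀
    have hKn : K ≤ (2 + 4 * Real.pi * supNorm f ^ 2) * (n : ℝ) ^ 2 := by
      have e1 := normSq2_le_supNorm hf
      have e2 : 4 * Real.pi * supNorm f ^ 2 ≤ 4 * Real.pi * supNorm f ^ 2 * (n : ℝ) ^ 2 :=
        le_mul_of_one_le_right (by positivity) (one_le_pow₀ hn1)
      rw [hK]
      linarith
    calc K * P.real B + K * κ
        ≤ K * (coverConst σ₀ / (n : ℝ) ^ 3) + K * κ := by gcongr
      _ = K * ((coverConst σ₀ + (4 / σ₀ ^ 2) ^ 3) / (n : ℝ) ^ 3) := by rw [hκ]; ring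
      _ ≤ ((2 + 4 * Real.pi * supNorm f ^ 2) * (n : ℝ) ^ 2)
          * ((coverConst σ₀ + (4 / σ₀ ^ 2) ^ 3) / (n : ℝ) ^ 3) := by gcongr
      _ = remainderConst σ₀ (supNorm f) * (1 / (n : ℝ)) := by
        rw [remainderConst]; field_simp
  have h1' := h1.trans_eq h2
  linarith

end Risk

/-! ### The bias over a Sobolev class -/

lemma rpow_dimS_le_sobolevWeight {β : ℝ} (hβ : 0 < β) (D j : ℕ) :
    (D : ℝ) ^ β ≤ sobolevWeight β (j + D) := by
  have h : (D : ℝ) ≤ ((j + D : ℕ) : ℝ) := by exact_mod_cast Nat.le_add_left D j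
  rw [sobolevWeight]
  split_ifs
  · exact Real.rpow_le_rpow (by positivity) h hβ.le
  · exact Real.rpow_le_rpow (by positivity) (by linarith) hβ.le

/-- The residual is the tail of squared coefficients from index `D_m` on, where every weight is at
least `D_m ^ β`. -/
lemma residual_le_of_mem_sobolevClass {β R : ℝ} (hβ : 0 < β) {f : ℝ → ℝ}
    (hf : f ∈ sobolevClass β R) (m : ℕ) :
    ((dimS m : ℝ) ^ β) ^ 2 * normSq2 (fun x => trigPoly (trigCoeff m f) x - f x)
      ≤ R ^ 2 / Real.pi ^ (2 * β) := by
  obtain ⟨hf2, hsum, hlt⟩ := hf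
  have h1 := (hasSum_residual (m := m) hf2).mul_left (((dimS m : ℝ) ^ β) ^ 2)
  set w : ℕ → ℝ := fun j => sobolevWeight β j ^ 2 * inner2 f (trig j) ^ 2 with hw
  have hw0 : ∀ j, 0 ≤ w j := fun j => by positivity
  have h2 : Summable fun j => w (j + dimS m) := (summable_nat_add_iff _).2 hsum
  have h3 : ∑' j, w (j + dimS m) ≤ ∑' j, w j := by
    rw [← hsum.sum_add_tsum_nat_add (dimS m)]
    exact le_add_of_nonneg_left (Finset.sum_nonneg fun j _ => hw0 j)
  refine (hasSum_le (fun j => ?_) h1 h2.hasSum).trans (h3.trans hlt.le)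
  refine mul_le_mul_of_nonneg_right ?_ (sq_nonneg _)
  exact pow_le_pow_left₀ (by positivity) (rpow_dimS_le_sobolevWeight hβ _ _) 2

/-- The lower bound on `D` controls the bias and the upper bound controls the variance; both become
`n ^ (-2β / (2β + 1))`, which dominates `1 / n`. -/
lemma rate_le {β S a b ρ D n c₁ c₂ c₃ : ℝ} (hβ : 0 < β) (ha : 0 < a) (hn : 1 ≤ n)
    (hc₁ : 0 ≤ c₁) (hc₂ : 0 ≤ c₂) (hc₃ : 0 ≤ c₃)
    (hρ : (D ^ β) ^ 2 * ρ ≤ S) (hρ0 : 0 ≤ ρ)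
    (hDa : a * n ^ (1 / (2 * β + 1)) ≤ D) (hDb : D ≤ b * n ^ (1 / (2 * β + 1))) :
    c₁ * ρ + c₂ * (D / n) + c₃ * (1 / n)
      ≤ (c₁ * (S / (a ^ β) ^ 2) + c₂ * b + c₃) * n ^ (-(2 * β) / (2 * β + 1)) := by
  have hn0 : 0 < n := by linarith
  have hden : 0 < 2 * β + 1 := by linarith
  set y := n ^ (-(2 * β) / (2 * β + 1)) with hy
  have hy0 : 0 < y := Real.rpow_pos_of_pos hn0 _
  have h1 : ρ ≤ S / (a ^ β) ^ 2 * y := by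
    -- The left side is `(a n ^ (1 / (2β + 1))) ^ (2β)`, so this is the lower bound on `D` raised to
    -- a power.
    have e1 : (a ^ β) ^ 2 * y⁻¹ ≤ (D ^ β) ^ 2 := by
      have : (a ^ β) ^ 2 * y⁻¹ = ((a * n ^ (1 / (2 * β + 1))) ^ β) ^ 2 := by
        rw [Real.mul_rpow ha.le (by positivity), mul_pow, ← Real.rpow_mul hn0.le, hy,
          ← Real.rpow_neg hn0.le, ← Real.rpow_mul_natCast hn0.le]
        congr 2
        push_cast
        field_simp
      rw [this]
      gcongr
    have e2 : (a ^ β) ^ 2 * y⁻¹ * ρ ≤ S := (mul_le_mul_of_nonneg_right e1 hρ0).trans hρ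
    have ha' : 0 < (a ^ β) ^ 2 := by positivity
    rw [div_mul_eq_mul_div, le_div_iff₀ ha']
    calc ρ * (a ^ β) ^ 2 = ((a ^ β) ^ 2 * y⁻¹ * ρ) * y := by field_simp
      _ ≤ S * y := by gcongr
  have h2 : D / n ≤ b * y := by
    have : b * y = b * n ^ (1 / (2 * β + 1)) / n := by
      rw [mul_div_assoc, ← Real.rpow_sub_one hn0.ne', hy]
      congr 2
      field_simp
      ring
    rw [this]
    gcongr
  have h3 : 1 / n ≤ y := by
    rw [one_div, ← Real.rpow_neg_one, hy]
    refine Real.rpow_le_rpow_of_exponent_le hn ?_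
    rw [le_div_iff₀ hden]
    linarith
  calc c₁ * ρ + c₂ * (D / n) + c₃ * (1 / n)
      ≤ c₁ * (S / (a ^ β) ^ 2 * y) + c₂ * (b * y) + c₃ * y := by gcongr
    _ = _ := by ring

end CircCensor

end

theorem theorem2 :
    ∃ (C₁ C₂ : ℝ → ℝ) (C₃ : ℝ → ℝ → ℝ),
      -- the bound on the mean integrated squared error
      (∀ (σ₀ : ℝ) (f : ℝ → ℝ) (ν : Measure (ℝ × ℝ)),
        0 < σ₀ → (∀ x ∈ CircCensor.circle, σ₀ ≤ CircCensor.sigma ν x) →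
        MemLp f ⊤ CircCensor.circleVol → (∀ᵐ x ∂CircCensor.circleVol, 0 ≤ f x) →
        ∀ (n m : ℕ), m ∈ CircCensor.indexSet n →
        ∀ (Ω : Type*) [MeasurableSpace Ω] (P : Measure Ω) [IsProbabilityMeasure P]
          (X L U : Fin n → Ω → ℝ), CircCensor.IsCensoredSample P f ν X L U →
        (∀ᵐ ω ∂P, ∃! t, CircCensor.IsLeastSquares (CircCensor.sampleObs X L U ω) m t) ∧
        Integrable (CircCensor.ise X L U m f) P ∧
        ∀ fm : ℝ → ℝ, CircCensor.IsProjection m f fm →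
          ∫ ω, CircCensor.ise X L U m f ω ∂P ≤
            C₁ σ₀ * CircCensor.normSq2 (fun x => fm x - f x)
              + C₂ σ₀ * ((CircCensor.dimS m : ℝ) / n)
              + C₃ σ₀ (CircCensor.supNorm f) * (1 / (n : ℝ))) ∧
      -- the rate on the Sobolev class when `D_m` is of order `n ^ (1 / (2 β + 1))`
      (∀ (β R a b : ℝ), 0 < β → 0 < R → 0 < a → 0 < b →
        ∃ C : ℝ → ℝ → ℝ,
        ∀ (σ₀ : ℝ) (f : ℝ → ℝ) (ν : Measure (ℝ × ℝ)),
        0 < σ₀ → (∀ x ∈ CircCensor.circle, σ₀ ≤ CircCensor.sigma ν x) →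
        MemLp f ⊤ CircCensor.circleVol → (∀ᵐ x ∂CircCensor.circleVol, 0 ≤ f x) →
        f ∈ CircCensor.sobolevClass β R →
        ∀ (n m : ℕ), m ∈ CircCensor.indexSet n →
        a * (n : ℝ) ^ (1 / (2 * β + 1)) ≤ (CircCensor.dimS m : ℝ) →
        (CircCensor.dimS m : ℝ) ≤ b * (n : ℝ) ^ (1 / (2 * β + 1)) →
        ∀ (Ω : Type*) [MeasurableSpace Ω] (P : Measure Ω) [IsProbabilityMeasure P]
          (X L U : Fin n → Ω → ℝ), CircCensor.IsCensoredSample P f ν X L U →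
        ∫ ω, CircCensor.ise X L U m f ω ∂P ≤
          C σ₀ (CircCensor.supNorm f) * (n : ℝ) ^ (-(2 * β) / (2 * β + 1))) := by
  refine ⟨fun σ₀ => 8 / σ₀ ^ 2 + 1, fun σ₀ => 8 / σ₀ ^ 2, CircCensor.remainderConst, ?_, ?_⟩
  · intro σ₀ f ν hσ₀ hσ hf hf0 n m hm Ω _ P _ X L U h
    have hn : 0 < n := by
      rw [CircCensor.indexSet, Finset.mem_Icc] at hm
      omega
    have hf2 : MemLp f 2 CircCensor.circleVol := hf.mono_exponent le_top
    refine ⟨CircCensor.ae_existsUnique h hn m, CircCensor.integrable_ise h hn hf2,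
      fun fm hfm => ?_⟩
    rw [hfm.eq_trigPoly hf2]
    exact CircCensor.integral_ise_le h hσ₀ hσ hf hf0 hm
  · intro β R a b hβ hR ha hb
    refine ⟨fun σ₀ M => (8 / σ₀ ^ 2 + 1) * (R ^ 2 / Real.pi ^ (2 * β) / (a ^ β) ^ 2)
      + 8 / σ₀ ^ 2 * b + CircCensor.remainderConst σ₀ M, ?_⟩
    intro σ₀ f ν hσ₀ hσ hf hf0 hfW n m hm hDa hDb Ω _ P _ X L U h
    have hn : 1 ≤ n := by
      rw [CircCensor.indexSet, Finset.mem_Icc] at hm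
      omega
    exact (CircCensor.integral_ise_le h hσ₀ hσ hf hf0 hm).trans
      (CircCensor.rate_le hβ ha (by exact_mod_cast hn) (by positivity)
        (by positivity) (CircCensor.remainderConst_nonneg hσ₀ _)
        (CircCensor.residual_le_of_mem_sobolevClass hβ hfW m) (CircCensor.normSq2_nonneg _)
        hDa hDb)
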